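/- **Conventions.** Composition in categories is written from left to right. All categories playing the role of algebraic structures are small, and all semigroups and small categories below are taken in one fixed universe. *Semigroups.* A semigroup $S$ is *regular* if every $a\in S$ has an $x\in S$ with $axa=a$, $xax=x$; it is *right reductive* if $a\mapsto\lambda_a$, $\lambda_a(x)=ax$, is injective. $\mathbf{RRS}$ is the full subcategory of the category of semigroups and homomorphisms consisting of the right reductive regular semigroups. On a regular semigroup put $a\leqslant_r b$ iff $a\in bS$, let $\mathscr R$ be the induced equivalence and order $S/\mathscr R$ by $\leqslant_r$; write $R_a$ for the class of $a$. *Normal categories.* A *category with subobjects* is a small category $\mathcal C$ with a subcategory $\mathcal P$ of *inclusions* on the same objects such that $\mathcal P$ is a strict preorder (at most one morphism between two objects, and only identities are isomorphisms), every inclusion is a monomorphism in $\mathcal C$, and $f=hg$ with $f,g\in\mathcal P$ implies $h\in\mathcal P$. Write $a\preceq b$ if there is an inclusion $j(a,b)\colon a\to b$. A *retraction* is a $q$ with $jq=1$ for some inclusion $j$. A *cone* $\gamma$ with vertex $z_\gamma$ is a family $\gamma(c)\colon c\to z_\gamma$, $c\in v\mathcal C$, with $j(a,b)\gamma(b)=\gamma(a)$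 whenever $a\preceq b$ and with at least one $\gamma(c)$ an isomorphism. $\mathcal C$ is *normal* if every inclusion $j$ has a $q$ with $jq=1$, every morphism is of the form $quj$ with $q$ a retraction, $u$ an isomorphism and $j$ an inclusion, and for each object $c$ there is a cone $\mu$ with vertex $c$ and $\mu(c)=1_c$. Every morphism $f$ of a normal category is uniquely $f=f^\circ j_f$ with $f^\circ$ an epimorphism and $j_f$ an inclusion. For a cone $\gamma$ and an epimorphism $f$ starting at $z_\gamma$ let $(\gamma*f)(c)=\gamma(c)f$. The set $\widehat{\mathcal C}$ of all cones is a regular semigroup under $\gamma\cdot\delta=\gamma*(\delta(z_\gamma))^\circ$. *Connected categories.* A *connected category* $\mathcal C_{\mathfrak D}$ is a normal category $\mathcal C$ with a down-set $\mathfrak D$ of $\widehat{\mathcal C}/\mathscr R$ such that every object $c$ is connected by some $\mathfrak d\in\mathfrak D$, i.e. $\mathfrak d$ contains an idempotent cone with vertex $c$ (it is then unique and denoted $\epsilon(c,\mathfrak d)$). A *CC-morphism* $\mathcal C_{\mathfrak D}\to\mathcal C'_{\mathfrak D'}$ is a pair $(F,G)$ of an inclusion preserving functor $F\colon\mathcal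 C\to\mathcal C'$ and an order preserving map $G\colon\mathfrak D\to\mathfrak D'$ such that, whenever $c$ is connected by $\mathfrak d$, $F(c)$ is connected by $G(\mathfrak d)$ and $F(\epsilon(c,\mathfrak d)(c'))=\epsilon(F(c),G(\mathfrak d))(F(c'))$ for all objects $c'$. $\mathbf{CC}$ is the category of connected categories and CC-morphisms. *The functor $\mathtt C\colon\mathbf{RRS}\to\mathbf{CC}$.* For a regular semigroup $S$, $\mathbb R(S)$ is the category whose objects are the right ideals $eS$, $e\in E(S)$, and whose morphisms $eS\to fS$ are the maps $l(e,u,f)\colon x\mapsto ux$ with $u\in fSe$; its inclusions are the inclusion maps. The *principal cone* $l^a$ has vertex $aS$ and components $l^a(eS)\colon x\mapsto ax$. Let $\mathfrak L$ be the set of $\mathscr R$-classes in $\widehat{\mathbb R(S)}$ (equivalently, $\mathscr L$-classes in the opposite semigroup $\widehat{\mathbb R(S)}^{\mathrm{op}}$) of the cones $l^e$, $e\in E(S)$. For $S$ in $\mathbf{RRS}$, $\mathtt C(S)=\mathbb R(S)_{\mathfrak L}$; for a homomorphism $\phi\colon S\to S'$, $\mathtt C(\phi)=(F_\phi,G_\phi)$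 with $F_\phi(eS)=\phi(e)S'$, $F_\phi(l(e,u,f))=l(\phi(e),\phi(u),\phi(f))$, and $G_\phi$ sends the class of $l^e$ to the class of $l^{\phi(e)}$. *The functor $\mathtt S\colon\mathbf{CC}\to\mathbf{RRS}$.* The *connection semigroup* of $\mathcal C_{\mathfrak D}$ is the subsemigroup $\widehat{\mathcal C_{\mathfrak D}}=\{\gamma\in\widehat{\mathcal C}: R_\gamma\in\mathfrak D\}$ of $\widehat{\mathcal C}$, and $\mathtt S(\mathcal C_{\mathfrak D})$ is the *dual connection semigroup*, i.e. the opposite semigroup of $\widehat{\mathcal C_{\mathfrak D}}$. For a CC-morphism $m=(F,G)$, $\mathtt S(m)$ is the homomorphism $\epsilon(c,\mathfrak d)*u\mapsto\epsilon(F(c),G(\mathfrak d))*F(u)$, $u$ an isomorphism (every cone in $\widehat{\mathcal C_{\mathfrak D}}$ is of the form $\epsilon(c,\mathfrak d)*u$ and the value does not depend on the representation). **Theorem.** $\mathtt C$ and $\mathtt S$ are well-defined (covariant) functors, and they are mutually quasi-inverse: there is an equivalence of categories $\mathbf{RRS}\simeq\mathbf{CC}$ whose functor is $\mathtt C\colon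 S\mapsto\mathbb R(S)_{\mathfrak L}$ and whose inverse is $\mathtt S\colon \mathcal C_{\mathfrak D}\mapsto\widehat{\mathcal C_{\mathfrak D}}^{\mathrm{op}}$. -/

import Mathlib

open CategoryTheory

universe u

namespace ConnCat

/-! ### Regular semigroups and the poset of `R`-classes -/

/-- A semigroup is regular if every element has an inverse `x`, i.e. `a x a = a`, `x a x = x`. -/
class RegularSemigroup (S : Type u) [Semigroup S] : Prop where
  exists_inverse : ∀ a : S, ∃ x : S, a * x * a = a ∧ x * a * x = x

/-- A semigroup is right reductive if the anti-regular representation, sending `a` to the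
left translation `x ↦ a x`, is injective. -/
class RightReductive (S : Type u) [Semigroup S] : Prop where
  injective : Function.Injective (fun a : S => fun x : S => a * x)

/-- The quasi-order `a ≤ᵣ b ↔ a ∈ b S`. -/
def RLe {S : Type u} [Semigroup S] (a b : S) : Prop := ∃ x : S, a = b * x

theorem RLe.refl {S : Type u} [Semigroup S] [RegularSemigroup S] (a : S) : RLe a a := by
  obtain ⟨x, hx, -⟩ := RegularSemigroup.exists_inverse a
  exact ⟨x * a, by rw [← mul_assoc, hx]⟩

theorem RLe.trans {S : Type u} [Semigroup S] {a b c : S} (h : RLe a b) (h' : RLe b c) :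
    RLe a c := by
  obtain ⟨x, rfl⟩ := h
  obtain ⟨y, rfl⟩ := h'
  exact ⟨y * x, mul_assoc _ _ _⟩

/-- Green's relation `R` on a regular semigroup. -/
def greenR (S : Type u) [Semigroup S] [RegularSemigroup S] : Setoid S where
  r a b := RLe a b ∧ RLe b a
  iseqv :=
    { refl := fun a => ⟨RLe.refl a, RLe.refl a⟩
      symm := fun h => ⟨h.2, h.1⟩
      trans := fun h h' => ⟨h.1.trans h'.1, h'.2.trans h.2⟩ }

/-- The set `S / R` of `R`-classes of a regular semigroup. -/
def RClass (S : Type u) [Semigroup S] [RegularSemigroup S] : Type u := Quotient (greenR S)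

/-- The `R`-class of an element. -/
def RClass.of {S : Type u} [Semigroup S] [RegularSemigroup S] (a : S) : RClass S :=
  Quotient.mk (greenR S) a

/-- The partial order on `S / R`: the class of `a` is below the class of `b` iff `a ≤ᵣ b`. -/
instance {S : Type u} [Semigroup S] [RegularSemigroup S] : PartialOrder (RClass S) where
  le := Quotient.lift₂ RLe (fun _ _ _ _ h h' => propext
    ⟨fun k => (h.2.trans k).trans h'.1, fun k => (h.1.trans k).trans h'.2⟩)
  le_refl a := Quotient.inductionOn a RLe.refl
  le_trans a b c := Quotient.inductionOn₃ a b c (fun _ _ _ h h' => RLe.trans h h')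
  le_antisymm a b := Quotient.inductionOn₂ a b (fun _ _ h h' => Quotient.sound ⟨h, h'⟩)

theorem RClass.of_le_of {S : Type u} [Semigroup S] [RegularSemigroup S] {a b : S} :
    RClass.of a ≤ RClass.of b ↔ RLe a b := Iff.rfl

theorem RClass.exists_of {S : Type u} [Semigroup S] [RegularSemigroup S] (d : RClass S) :
    ∃ a, RClass.of a = d := Quotient.exists_rep d

/-! ### Categories with subobjects and normal categories -/

/-- A small category with subobjects: a small category together with a wide subcategory of
`inclusions` which is a strict preorder, consists of monomorphisms, and contains `h` whenever
it contains `g` and `h ≫ g`. -/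
class CategoryWithSubobjects (C : Type u) [SmallCategory C] where
  incl : MorphismProperty C
  incl_id : ∀ c : C, incl (𝟙 c)
  incl_comp : ∀ {a b c : C} (f : a ⟶ b) (g : b ⟶ c), incl f → incl g → incl (f ≫ g)
  incl_unique : ∀ {a b : C} (f g : a ⟶ b), incl f → incl g → f = g
  incl_antisymm : ∀ {a b : C} (f : a ⟶ b) (g : b ⟶ a), incl f → incl g → a = b
  incl_mono : ∀ {a b : C} (f : a ⟶ b), incl f → Mono f
  incl_of_comp : ∀ {a b c : C} (h : a ⟶ b) (g : b ⟶ c), incl (h ≫ g) → incl g → incl h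

section Subobjects

variable {C : Type u} [SmallCategory C] [CategoryWithSubobjects C]

/-- The morphism `j` is an inclusion. -/
def IsIncl {a b : C} (j : a ⟶ b) : Prop := CategoryWithSubobjects.incl j

/-- A retraction is a right inverse `q` of an inclusion `j`, i.e. `j ≫ q = 𝟙`. -/
def IsRetraction {a b : C} (q : b ⟶ a) : Prop := ∃ j : a ⟶ b, IsIncl j ∧ j ≫ q = 𝟙 a

/-- `f = q u j` with `q` a retraction, `u` an isomorphism and `j` an inclusion. -/
def HasNormalFactorisation {a b : C} (f : a ⟶ b) : Prop :=
  ∃ (a' b' : C) (q : a ⟶ a') (u : a' ⟶ b') (j : b' ⟶ b),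
    IsRetraction q ∧ IsIso u ∧ IsIncl j ∧ f = q ≫ u ≫ j

variable (C) in
/-- A cone in a category with subobjects. -/
@[ext]
structure NCone where
  vertex : C
  app : ∀ c : C, c ⟶ vertex
  compat : ∀ {a b : C} (j : a ⟶ b), IsIncl j → j ≫ app b = app a
  exists_iso : ∃ c : C, IsIso (app c)

end Subobjects

/-- A normal category: inclusions split, morphisms have normal factorisations, and each object
`c` is the vertex of a cone with identity component at `c`. -/
class NormalCategory (C : Type u) [SmallCategory C] [CategoryWithSubobjects C] : Prop where
  incl_split : ∀ {a b : C} (j : a ⟶ b), IsIncl j → ∃ q : b ⟶ a, j ≫ q = 𝟙 a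
  exists_normalFactorisation : ∀ {a b : C} (f : a ⟶ b), HasNormalFactorisation f
  exists_cone : ∀ c : C, ∃ μ : NCone C, μ.vertex = c ∧ μ.app μ.vertex = 𝟙 μ.vertex

section Normal

variable {C : Type u} [SmallCategory C] [CategoryWithSubobjects C]

theorem IsRetraction.epi {a b : C} {q : b ⟶ a} (h : IsRetraction q) : Epi q := by
  obtain ⟨j, -, h⟩ := h
  exact ⟨fun f g hfg => by
    have : j ≫ q ≫ f = j ≫ q ≫ g := by rw [hfg]
    simpa [← Category.assoc, h] using this⟩

theorem IsIncl.mono {a b : C} {j : a ⟶ b} (h : IsIncl j) : Mono j :=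
  CategoryWithSubobjects.incl_mono j h

/-- An epimorphism followed by an inclusion. -/
theorem exists_canonicalFactorisation [NormalCategory C] {a b : C} (f : a ⟶ b) :
    ∃ (z : C) (p : a ⟶ z) (j : z ⟶ b), Epi p ∧ IsIncl j ∧ f = p ≫ j := by
  obtain ⟨a', b', q, u, j, hq, hu, hj, rfl⟩ :=
    NormalCategory.exists_normalFactorisation f
  have := hq.epi
  exact ⟨b', q ≫ u, j, inferInstance, hj, by simp⟩

/-- The image of a morphism `f`: the middle object of its canonical factorisation `f = p j`
into an epimorphism followed by an inclusion. -/
noncomputable def im [NormalCategory C] {a b : C} (f : a ⟶ b) : C :=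
  (exists_canonicalFactorisation f).choose

/-- The epimorphic component `f°` of a morphism `f`. -/
noncomputable def epiPart [NormalCategory C] {a b : C} (f : a ⟶ b) : a ⟶ im f :=
  (exists_canonicalFactorisation f).choose_spec.choose

/-- The inclusion of the image of `f`. -/
noncomputable def imIncl [NormalCategory C] {a b : C} (f : a ⟶ b) : im f ⟶ b :=
  (exists_canonicalFactorisation f).choose_spec.choose_spec.choose

theorem canonicalFactorisation_spec [NormalCategory C] {a b : C} (f : a ⟶ b) :
    Epi (epiPart f) ∧ IsIncl (imIncl f) ∧ f = epiPart f ≫ imIncl f :=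
  (exists_canonicalFactorisation f).choose_spec.choose_spec.choose_spec

instance [NormalCategory C] {a b : C} (f : a ⟶ b) : Epi (epiPart f) :=
  (canonicalFactorisation_spec f).1

/-- Every epimorphism of a normal category is a retraction followed by an isomorphism. -/
theorem epi_factor [NormalCategory C] {a b : C} (p : a ⟶ b) [Epi p] :
    ∃ (a' : C) (q : a ⟶ a') (u : a' ⟶ b), IsRetraction q ∧ IsIso u ∧ p = q ≫ u := by
  obtain ⟨a', b', q, u, j, hq, hu, hj, rfl⟩ :=
    NormalCategory.exists_normalFactorisation p
  obtain ⟨r, hr⟩ := NormalCategory.incl_split j hj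
  have hje : Epi j := by
    have : Epi ((q ≫ u) ≫ j) := by simpa using ‹Epi (q ≫ u ≫ j)›
    exact epi_of_epi (q ≫ u) j
  have hrj : r ≫ j = 𝟙 b := by
    rw [← cancel_epi j, ← Category.assoc, hr]; simp
  have hri : IsIncl r := CategoryWithSubobjects.incl_of_comp r j
    (by rw [hrj]; exact CategoryWithSubobjects.incl_id b) hj
  obtain rfl := CategoryWithSubobjects.incl_antisymm j r hj hri
  obtain rfl : j = 𝟙 _ := CategoryWithSubobjects.incl_unique _ _ hj
    (CategoryWithSubobjects.incl_id _)
  exact ⟨a', q, u, hq, hu, by simp⟩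

/-- The canonical factorisation is unique. -/
theorem canonicalFactorisation_unique [NormalCategory C] {a b z : C} (f : a ⟶ b)
    (p : a ⟶ z) (j : z ⟶ b) (hp : Epi p) (hj : IsIncl j) (h : f = p ≫ j) :
    ∃ e : z = im f, epiPart f = p ≫ eqToHom e ∧ imIncl f = eqToHom e.symm ≫ j := by
  have key : ∀ {x y : C} (p : a ⟶ x) (j : x ⟶ b) (p' : a ⟶ y) (j' : y ⟶ b), Epi p →
      IsIncl j → IsIncl j' → p ≫ j = p' ≫ j' → ∃ i : x ⟶ y, IsIncl i := by
    intro x y p j p' j' hp hj hj' e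
    obtain ⟨a', q, u, ⟨s, -, hs⟩, hu, rfl⟩ := epi_factor p
    refine ⟨inv u ≫ s ≫ p', CategoryWithSubobjects.incl_of_comp _ j' ?_ hj'⟩
    have : (inv u ≫ s ≫ p') ≫ j' = j := by
      simp only [Category.assoc, ← e]
      rw [← Category.assoc s q, hs]; simp
    rw [this]; exact hj
  obtain ⟨hp', hj', h'⟩ := canonicalFactorisation_spec f
  obtain ⟨i, hi⟩ := key p j _ _ hp hj hj' (h.symm.trans h')
  obtain ⟨i', hi'⟩ := key _ _ p j hp' hj' hj (h'.symm.trans h)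
  have e := CategoryWithSubobjects.incl_antisymm i i' hi hi'
  refine ⟨e, ?_⟩
  generalize epiPart f = p' at *
  generalize imIncl f = j' at *
  generalize im f = z' at *
  subst e
  obtain rfl := CategoryWithSubobjects.incl_unique _ _ hj hj'
  have := hj.mono
  exact ⟨by simpa using (cancel_mono j).1 (h'.symm.trans h), by simp⟩

/-! ### The semigroup of cones -/

namespace NCone

/-- The cone `γ * f` for an epimorphism `f` starting at the vertex of `γ`. -/
def star [NormalCategory C] (γ : NCone C) {z : C} (f : γ.vertex ⟶ z) (hf : Epi f) :
    NCone C where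
  vertex := z
  app c := γ.app c ≫ f
  compat j hj := by rw [← Category.assoc, γ.compat j hj]
  exists_iso := by
    obtain ⟨c, hc⟩ := γ.exists_iso
    obtain ⟨c', q, u, ⟨j, hj, hjq⟩, hu, e⟩ := epi_factor (γ.app c ≫ f)
    refine ⟨c', ?_⟩
    have : γ.app c' ≫ f = u := by
      rw [← γ.compat j hj, Category.assoc, e, ← Category.assoc, hjq, Category.id_comp]
    rw [this]; exact hu

/-- The product of cones: `γ · δ = γ * (δ(z_γ))°`. -/
noncomputable instance [NormalCategory C] : Mul (NCone C) where
  mul γ δ := γ.star (epiPart (δ.app γ.vertex)) inferInstance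

/-- Two cones which agree after composing with inclusions of their vertices into a common
object are equal. -/
theorem eq_of_incl {γ δ : NCone C} {b : C} (i : γ.vertex ⟶ b) (k : δ.vertex ⟶ b)
    (hi : IsIncl i) (hk : IsIncl k) (h : ∀ c, γ.app c ≫ i = δ.app c ≫ k) : γ = δ := by
  have key : ∀ {γ δ : NCone C} (i : γ.vertex ⟶ b) (k : δ.vertex ⟶ b), IsIncl i → IsIncl k →
      (∀ c, γ.app c ≫ i = δ.app c ≫ k) → ∃ l : γ.vertex ⟶ δ.vertex, IsIncl l := by
    intro γ δ i k hi hk h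
    obtain ⟨c, hc⟩ := γ.exists_iso
    refine ⟨inv (γ.app c) ≫ δ.app c, CategoryWithSubobjects.incl_of_comp _ k ?_ hk⟩
    have : (inv (γ.app c) ≫ δ.app c) ≫ k = i := by
      rw [Category.assoc, ← h]; simp
    rw [this]; exact hi
  obtain ⟨l, hl⟩ := key i k hi hk h
  obtain ⟨l', hl'⟩ := key k i hk hi (fun c => (h c).symm)
  have e := CategoryWithSubobjects.incl_antisymm l l' hl hl'
  obtain ⟨z, γa, γc, γi⟩ := γ
  obtain ⟨z', δa, δc, δi⟩ := δ
  dsimp only at *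
  subst e
  obtain rfl := CategoryWithSubobjects.incl_unique _ _ hi hk
  have := hi.mono
  have : γa = δa := funext fun c => (cancel_mono i).1 (h c)
  subst this
  rfl

/-- The inclusion of the vertex of a product into the vertex of the second factor. -/
noncomputable def mulIncl [NormalCategory C] (γ δ : NCone C) :
    (γ * δ).vertex ⟶ δ.vertex := imIncl (δ.app γ.vertex)

theorem isIncl_mulIncl [NormalCategory C] (γ δ : NCone C) : IsIncl (mulIncl γ δ) :=
  (canonicalFactorisation_spec (δ.app γ.vertex)).2.1

theorem mul_app [NormalCategory C] (γ δ : NCone C) (c : C) :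
    (γ * δ).app c ≫ mulIncl γ δ = γ.app c ≫ δ.app γ.vertex := by
  change (γ.app c ≫ epiPart _) ≫ imIncl _ = _
  rw [Category.assoc, ← (canonicalFactorisation_spec (δ.app γ.vertex)).2.2]

/-- Characterisation of the product of cones. -/
theorem eq_mul [NormalCategory C] {γ δ σ : NCone C} (i : σ.vertex ⟶ δ.vertex) (hi : IsIncl i)
    (h : ∀ c, σ.app c ≫ i = γ.app c ≫ δ.app γ.vertex) : σ = γ * δ :=
  eq_of_incl i (mulIncl γ δ) hi (isIncl_mulIncl γ δ) fun c => by rw [h, mul_app]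

noncomputable instance [NormalCategory C] : Semigroup (NCone C) where
  mul_assoc γ δ σ := by
    refine eq_of_incl (mulIncl (γ * δ) σ) (mulIncl γ (δ * σ) ≫ mulIncl δ σ)
      (isIncl_mulIncl _ _) (CategoryWithSubobjects.incl_comp _ _ (isIncl_mulIncl _ _)
        (isIncl_mulIncl _ _)) fun c => ?_
    have h : (γ * (δ * σ)).app c ≫ mulIncl γ (δ * σ) ≫ mulIncl δ σ =
        γ.app c ≫ δ.app γ.vertex ≫ σ.app δ.vertex := by
      rw [← Category.assoc, mul_app, Category.assoc, mul_app]
    rw [h, mul_app, ← σ.compat _ (isIncl_mulIncl γ δ), ← Category.assoc, mul_app,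
      Category.assoc]

theorem idem_of_app [NormalCategory C] {μ : NCone C} (h : μ.app μ.vertex = 𝟙 μ.vertex) :
    IsIdempotentElem μ :=
  (eq_mul (𝟙 _) (CategoryWithSubobjects.incl_id _) fun c => by rw [h]).symm

theorem app_vertex_of_idem [NormalCategory C] {μ : NCone C} (h : IsIdempotentElem μ) :
    μ.app μ.vertex = 𝟙 μ.vertex := by
  obtain ⟨c, hc⟩ := μ.exists_iso
  have hv : ∀ ν : NCone C, ν = μ → ∀ i : ν.vertex ⟶ μ.vertex, IsIncl i →
      ν.app c ≫ i = μ.app c := by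
    rintro ν rfl i hi
    obtain rfl := CategoryWithSubobjects.incl_unique _ _ hi (CategoryWithSubobjects.incl_id _)
    simp
  have := hv _ h _ (isIncl_mulIncl μ μ)
  rw [mul_app] at this
  rw [← cancel_epi (μ.app c), this]; simp

theorem mul_app_of_eq [NormalCategory C] {γ δ σ : NCone C} (h : σ = γ * δ) :
    ∃ i : σ.vertex ⟶ δ.vertex, IsIncl i ∧ ∀ c, σ.app c ≫ i = γ.app c ≫ δ.app γ.vertex := by
  subst h
  exact ⟨mulIncl γ δ, isIncl_mulIncl γ δ, mul_app γ δ⟩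

theorem isIncl_eqToHom {a b : C} (h : a = b) : IsIncl (eqToHom h) := by
  subst h
  exact CategoryWithSubobjects.incl_id _

theorem isIncl_self {a : C} {i : a ⟶ a} (h : IsIncl i) : i = 𝟙 a :=
  CategoryWithSubobjects.incl_unique _ _ h (CategoryWithSubobjects.incl_id _)

/-- If `f` followed by an inclusion `i` is an isomorphism, so are `i` and `f`. -/
theorem isIso_of_comp_incl {a b c : C} (f : a ⟶ b) (i : b ⟶ c) (hi : IsIncl i)
    (h : IsIso (f ≫ i)) : IsIso f := by
  have := hi.mono
  have h1 : i ≫ (inv (f ≫ i) ≫ f) = 𝟙 b := by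
    rw [← cancel_mono i]; simp
  have : IsIso i := ⟨inv (f ≫ i) ≫ f, h1, by simp⟩
  exact IsIso.of_isIso_comp_right f i

theorem app_eq_eqToHom [NormalCategory C] {μ : NCone C} (h : IsIdempotentElem μ) {z : C}
    (hz : μ.vertex = z) : μ.app z = eqToHom hz.symm := by
  subst hz
  exact app_vertex_of_idem h

theorem rle_app [NormalCategory C] {σ ρ : NCone C} (h : RLe σ ρ) :
    ∃ f : ρ.vertex ⟶ σ.vertex, ∀ c, σ.app c = ρ.app c ≫ f := by
  obtain ⟨x, h⟩ := h
  obtain ⟨i, hi, h⟩ := mul_app_of_eq h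
  obtain ⟨r, hr⟩ := NormalCategory.incl_split i hi
  refine ⟨x.app ρ.vertex ≫ r, fun c => ?_⟩
  rw [← Category.assoc, ← h, Category.assoc, hr, Category.comp_id]

theorem eq_of_rle [NormalCategory C] {σ τ ρ : NCone C} (hσ : RLe σ ρ) (hτ : RLe τ ρ) {a : C}
    (ha : IsIso (ρ.app a)) {b : C} (i : σ.vertex ⟶ b) (k : τ.vertex ⟶ b) (hi : IsIncl i)
    (hk : IsIncl k) (h : σ.app a ≫ i = τ.app a ≫ k) : σ = τ := by
  obtain ⟨f, hf⟩ := rle_app hσ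
  obtain ⟨g, hg⟩ := rle_app hτ
  refine eq_of_incl i k hi hk fun c => ?_
  have : f ≫ i = g ≫ k := by
    rw [← cancel_epi (ρ.app a), ← Category.assoc, ← hf, h, hg, Category.assoc]
  rw [hf, hg, Category.assoc, this, Category.assoc]

/-- An idempotent cone is determined by its vertex and its `R`-class. -/
theorem idem_unique [NormalCategory C] {ε ε' : NCone C} (h : IsIdempotentElem ε)
    (h' : IsIdempotentElem ε') (hR : RLe ε ε') (hv : ε.vertex = ε'.vertex) : ε = ε' := by
  obtain ⟨f, hf⟩ := rle_app hR
  refine eq_of_incl (𝟙 _) (eqToHom hv.symm) (isIncl_eqToHom rfl) (isIncl_eqToHom _) fun c => ?_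
  have : f = eqToHom hv.symm := by
    have := hf ε'.vertex
    rw [app_vertex_of_idem h', Category.id_comp] at this
    rw [← this, app_eq_eqToHom h hv]
  rw [hf, this, Category.comp_id]

/-- `γ * f` is the product of `γ` with any cone whose component at the vertex of `γ` is `f`. -/
theorem star_eq_mul [NormalCategory C] (γ δ : NCone C) (f : γ.vertex ⟶ δ.vertex) (hf : Epi f)
    (h : δ.app γ.vertex = f) : γ.star f hf = γ * δ :=
  eq_mul (σ := γ.star f hf) (𝟙 _) (isIncl_eqToHom rfl) fun c => by
    rw [h]; exact Category.comp_id _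

theorem star_rle [NormalCategory C] {ε : NCone C} (hε : IsIdempotentElem ε) {z : C}
    (f : ε.vertex ⟶ z) (hf : Epi f) : RLe (ε.star f hf) ε :=
  ⟨ε.star f hf, star_eq_mul ε (ε.star f hf) f hf (by
    change ε.app ε.vertex ≫ f = f
    rw [app_vertex_of_idem hε, Category.id_comp])⟩

theorem exists_idem [NormalCategory C] (z : C) :
    ∃ ν : NCone C, IsIdempotentElem ν ∧ ν.vertex = z := by
  obtain ⟨μ, hμ, hμ'⟩ := NormalCategory.exists_cone z
  exact ⟨μ, idem_of_app hμ', hμ⟩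

/-- Inverses in the semigroup of cones, with control of the `R`-class. -/
theorem exists_inverse_rle [NormalCategory C] (γ ε : NCone C) (hε : IsIdempotentElem ε)
    (hv : ε.vertex = γ.vertex) :
    ∃ χ, RLe χ ε ∧ γ * χ * γ = γ ∧ χ * γ * χ = χ := by
  obtain ⟨d, hd⟩ := γ.exists_iso
  obtain ⟨χ, hr, h, hχγ⟩ : ∃ χ : NCone C, RLe χ ε ∧ ∃ h : χ.vertex = d,
      χ.app γ.vertex = inv (γ.app d) ≫ eqToHom h.symm := by
    refine ⟨ε.star (eqToHom hv ≫ inv (γ.app d)) inferInstance, star_rle hε _ _, rfl, ?_⟩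
    change ε.app _ ≫ _ = _
    rw [app_eq_eqToHom hε hv]
    simp only [eqToHom_trans_assoc, eqToHom_refl, Category.id_comp]
    exact (Category.comp_id _).symm
  subst h
  rw [eqToHom_refl, Category.comp_id] at hχγ
  refine ⟨χ, hr, ?_, ?_⟩
  · refine (eq_mul (𝟙 _) (isIncl_eqToHom rfl) fun c => ?_).symm
    rw [← γ.compat _ (isIncl_mulIncl γ χ), ← Category.assoc, mul_app, hχγ]; simp
  · refine (eq_mul (𝟙 _) (isIncl_eqToHom rfl) fun c => ?_).symm
    rw [← χ.compat _ (isIncl_mulIncl χ γ), ← Category.assoc, mul_app, hχγ]; simp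

instance [NormalCategory C] : RegularSemigroup (NCone C) where
  exists_inverse γ := by
    obtain ⟨ε, hε, hv⟩ := exists_idem γ.vertex
    obtain ⟨χ, -, h, h'⟩ := exists_inverse_rle γ ε hε hv
    exact ⟨χ, h, h'⟩

/-- Multiplying by an isomorphism does not change the `R`-class. -/
theorem of_star [NormalCategory C] {ε : NCone C} (hε : IsIdempotentElem ε) {z : C}
    (u : ε.vertex ⟶ z) (hu : IsIso u) : RClass.of (ε.star u inferInstance) = RClass.of ε := by
  refine le_antisymm (star_rle hε u _) ?_
  obtain ⟨ν, hν, hv⟩ := exists_idem z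
  subst hv
  refine ⟨ν.star (inv u) inferInstance, ?_⟩
  refine eq_mul (𝟙 _) (isIncl_eqToHom rfl) fun c => ?_
  change ε.app c ≫ 𝟙 _ = (ε.app c ≫ u) ≫ ν.app ν.vertex ≫ inv u
  rw [app_vertex_of_idem hν]; simp

/-- Every cone is `ε * u` for an idempotent cone `ε` in its `R`-class and an isomorphism `u`. -/
theorem exists_eq_star [NormalCategory C] (γ : NCone C) :
    ∃ (ε : NCone C) (u : ε.vertex ⟶ γ.vertex) (_ : IsIso u), IsIdempotentElem ε ∧
      RClass.of ε = RClass.of γ ∧ γ = ε.star u inferInstance := by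
  obtain ⟨x, hx, -⟩ := RegularSemigroup.exists_inverse γ
  have hε : IsIdempotentElem (γ * x) := by
    change γ * x * (γ * x) = γ * x
    rw [← mul_assoc, hx]
  have h1 : RLe γ (γ * x) := ⟨γ, hx.symm⟩
  have h2 : RLe (γ * x) γ := ⟨x, rfl⟩
  generalize γ * x = ε at *
  obtain ⟨f, hf⟩ := rle_app h1
  obtain ⟨g, hg⟩ := rle_app h2
  obtain ⟨d, hd⟩ := ε.exists_iso
  obtain ⟨d', hd'⟩ := γ.exists_iso
  have hfg : f ≫ g = 𝟙 _ := by
    rw [← cancel_epi (ε.app d), ← Category.assoc, ← hf, ← hg, Category.comp_id]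
  have hgf : g ≫ f = 𝟙 _ := by
    rw [← cancel_epi (γ.app d'), ← Category.assoc, ← hg, ← hf, Category.comp_id]
  refine ⟨ε, f, ⟨g, hfg, hgf⟩, hε, le_antisymm h2 h1, ?_⟩
  exact eq_of_incl (δ := ε.star f _) (𝟙 _) (𝟙 _) (isIncl_eqToHom rfl) (isIncl_eqToHom rfl)
    fun c => by rw [hf]; rfl

end NCone

/-- The object `c` is connected by the `R`-class `d` if `d` contains an idempotent cone with
vertex `c`. -/
def ConnectedBy [NormalCategory C] (c : C) (d : RClass (NCone C)) : Prop :=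
  ∃ ε : NCone C, IsIdempotentElem ε ∧ ε.vertex = c ∧ RClass.of ε = d

end Normal

/-! ### The category of connected categories -/

/-- A connected category: a normal category `C` with a down-set `D` of the poset of
`R`-classes of the semigroup of cones in `C`, such that each object of `C` is connected by some
member of `D`. -/
structure CC : Type (u + 1) where
  carrier : Type u
  [cat : SmallCategory carrier]
  [sub : CategoryWithSubobjects carrier]
  [normal : NormalCategory carrier]
  D : LowerSet (RClass (NCone carrier))
  connected : ∀ c : carrier, ∃ d ∈ D, ConnectedBy c d

attribute [instance] CC.cat CC.sub CC.normal

namespace CC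

/-- A CC-morphism `(F, G)`. The last two fields say that if `c` is connected by `d` then `F c`
is connected by `G d`, and that `F` maps the components of the idempotent cone `ε(c, d)` to
those of the idempotent cone `ε(F c, G d)`. -/
@[ext]
structure Hom (X Y : CC.{u}) where
  F : X.carrier ⥤ Y.carrier
  map_incl : ∀ {a b : X.carrier} (j : a ⟶ b), IsIncl j → IsIncl (F.map j)
  G : X.D →o Y.D
  map_connected : ∀ (c : X.carrier) (d : X.D),
    ConnectedBy c d.1 → ConnectedBy (F.obj c) (G d).1
  map_app : ∀ (d : X.D) (ε : NCone X.carrier) (ε' : NCone Y.carrier),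
    IsIdempotentElem ε → RClass.of ε = d.1 → IsIdempotentElem ε' → RClass.of ε' = (G d).1 →
    ∀ (hv : ε'.vertex = F.obj ε.vertex) (c : X.carrier),
      F.map (ε.app c) ≫ eqToHom hv.symm = ε'.app (F.obj c)

/-- Connected categories and CC-morphisms form a category. -/
noncomputable instance : Category CC.{u} where
  Hom := Hom
  id X :=
    { F := 𝟭 _
      map_incl := fun _ hj => hj
      G := OrderHom.id
      map_connected := fun _ _ h => h
      map_app := fun d ε ε' h hd h' hd' hv c => by
        obtain rfl := NCone.idem_unique h' h
          (RClass.of_le_of.1 (le_of_eq (hd'.trans hd.symm))) hv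
        simp }
  comp {X Y Z} m n :=
    { F := m.F ⋙ n.F
      map_incl := fun j hj => n.map_incl _ (m.map_incl j hj)
      G := n.G.comp m.G
      map_connected := fun c d h => n.map_connected _ _ (m.map_connected c d h)
      map_app := fun d ε ε' h hd h' hd' hv c => by
        obtain ⟨ε₁, h₁, hv₁, hd₁⟩ := m.map_connected ε.vertex d ⟨ε, h, rfl, hd⟩
        have e₁ := m.map_app d ε ε₁ h hd h₁ hd₁ hv₁ c
        have e₂ := n.map_app _ ε₁ ε' h₁ hd₁ h' hd' (hv.trans (by rw [hv₁]; rfl)) (m.F.obj c)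
        rw [← e₁] at e₂
        simp only [Functor.map_comp, eqToHom_map, Category.assoc, eqToHom_trans] at e₂
        exact e₂ }

/-! ### The connection semigroup -/

/-- The connection semigroup: the cones whose `R`-class lies in `D`, as a subsemigroup of the
semigroup of all cones. -/
noncomputable def connSemigroup (X : CC.{u}) : Subsemigroup (NCone X.carrier) where
  carrier := {γ | RClass.of γ ∈ X.D}
  mul_mem' {_ δ} hγ _ := X.D.lower (RClass.of_le_of.2 ⟨δ, rfl⟩) hγ

instance (X : CC.{u}) : RegularSemigroup X.connSemigroup where
  exists_inverse := by
    rintro ⟨γ, hγ⟩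
    obtain ⟨d, hd, ε, hε, hv, rfl⟩ := X.connected γ.vertex
    obtain ⟨χ, hχ, h, h'⟩ := NCone.exists_inverse_rle γ ε hε hv
    exact ⟨⟨χ, X.D.lower (RClass.of_le_of.2 hχ) hd⟩, Subtype.ext h, Subtype.ext h'⟩

/-- The dual connection semigroup: the opposite of the connection semigroup. -/
abbrev dualConnSemigroup (X : CC.{u}) : Type u := (X.connSemigroup)ᵐᵒᵖ

instance (X : CC.{u}) : RegularSemigroup X.dualConnSemigroup where
  exists_inverse a := by
    obtain ⟨x, h, h'⟩ := RegularSemigroup.exists_inverse a.unop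
    refine ⟨MulOpposite.op x, MulOpposite.unop_injective ?_, MulOpposite.unop_injective ?_⟩
    · simpa [mul_assoc] using h
    · simpa [mul_assoc] using h'

instance (X : CC.{u}) : RightReductive X.dualConnSemigroup where
  injective := by
    intro a b hab
    have hl : ∀ γ₁ γ₂ : X.connSemigroup, (∀ γ, γ * γ₁ = γ * γ₂) →
        ∃ i : γ₁.1.vertex ⟶ γ₂.1.vertex, IsIncl i := by
      intro γ₁ γ₂ h
      obtain ⟨x, hx, -⟩ := RegularSemigroup.exists_inverse γ₁
      have := h (γ₁ * x)
      rw [hx] at this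
      obtain ⟨i, hi, -⟩ := NCone.mul_app_of_eq (congrArg Subtype.val this)
      exact ⟨i, hi⟩
    have h : ∀ γ, γ * a.unop = γ * b.unop := fun γ => by
      have := congrArg MulOpposite.unop (congrFun hab (MulOpposite.op γ))
      simpa using this
    obtain ⟨i, hi⟩ := hl _ _ h
    refine MulOpposite.unop_injective (Subtype.ext ?_)
    refine NCone.eq_of_incl i (𝟙 _) hi (NCone.isIncl_eqToHom rfl) fun c => ?_
    obtain ⟨d, hd, ε, hε, rfl, rfl⟩ := X.connected c
    obtain ⟨j₁, hj₁, e₁⟩ := NCone.mul_app_of_eq (rfl : ε * a.unop.1 = _)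
    obtain ⟨j₂, hj₂, e₂⟩ := NCone.mul_app_of_eq
      (congrArg Subtype.val (h ⟨ε, hd⟩) : ε * a.unop.1 = ε * b.unop.1)
    have e : j₁ ≫ i = j₂ := CategoryWithSubobjects.incl_unique _ _
      (CategoryWithSubobjects.incl_comp _ _ hj₁ hi) hj₂
    have e₁ := e₁ ε.vertex
    have e₂ := e₂ ε.vertex
    rw [NCone.app_vertex_of_idem hε, Category.id_comp] at e₁ e₂
    rw [← e₁, Category.assoc, e, Category.comp_id]
    exact e₂

/-- `γ` has the form `ε(c, d) * u` with `u` an isomorphism, and `γ'` is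
`ε(F c, G d) * F u`. -/
def Hom.IsImage {X Y : CC.{u}} (m : X.Hom Y) (γ : NCone X.carrier) (γ' : NCone Y.carrier) :
    Prop :=
  ∃ (d : X.D) (ε : NCone X.carrier) (ε' : NCone Y.carrier) (z : X.carrier)
    (u : ε.vertex ⟶ z) (_ : IsIso u) (hv : ε'.vertex = m.F.obj ε.vertex),
    IsIdempotentElem ε ∧ RClass.of ε = d.1 ∧ IsIdempotentElem ε' ∧ RClass.of ε' = (m.G d).1 ∧
    γ = ε.star u inferInstance ∧ γ' = ε'.star (eqToHom hv ≫ m.F.map u) inferInstance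

theorem Hom.exists_isImage {X Y : CC.{u}} (m : X.Hom Y) (γ : X.connSemigroup) :
    ∃ γ', m.IsImage γ.1 γ' := by
  obtain ⟨γ, hγ⟩ := γ
  obtain ⟨ε, u, hu, hε, hR, e⟩ := γ.exists_eq_star
  obtain ⟨ε', hε', hv, hd⟩ := m.map_connected ε.vertex ⟨_, hγ⟩ ⟨ε, hε, rfl, hR⟩
  exact ⟨_, ⟨_, hγ⟩, ε, ε', _, u, hu, hv, hε, hR, hε', hd, e, rfl⟩

theorem Hom.IsImage.spec {X Y : CC.{u}} {m : X.Hom Y} {γ : NCone X.carrier}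
    {γ' : NCone Y.carrier} (h : m.IsImage γ γ') (hγ : RClass.of γ ∈ X.D) :
    RClass.of γ' = (m.G ⟨RClass.of γ, hγ⟩).1 ∧
    ∃ i : γ'.vertex ⟶ m.F.obj γ.vertex, IsIncl i ∧
      ∀ c, γ'.app (m.F.obj c) ≫ i = m.F.map (γ.app c) := by
  obtain ⟨d, ε, ε', z, u, hu, hv, hε, hd, hε', hd', rfl, rfl⟩ := h
  have e := NCone.of_star hε u hu
  refine ⟨?_, 𝟙 _, NCone.isIncl_eqToHom rfl, fun c => ?_⟩
  · rw [NCone.of_star hε' _ inferInstance, hd']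
    congr 2
    exact Subtype.ext (hd.symm.trans e.symm)
  · have := m.map_app d ε ε' hε hd hε' hd' hv c
    change (ε'.app (m.F.obj c) ≫ eqToHom hv ≫ m.F.map u) ≫ 𝟙 _ = m.F.map (ε.app c ≫ u)
    rw [← this]; simp

theorem Hom.image_unique {X Y : CC.{u}} (m : X.Hom Y) {γ : NCone X.carrier}
    {σ τ : NCone Y.carrier} (hR : RClass.of σ = RClass.of τ)
    (hσ : ∃ i : σ.vertex ⟶ m.F.obj γ.vertex, IsIncl i ∧
      ∀ c, σ.app (m.F.obj c) ≫ i = m.F.map (γ.app c))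
    (hτ : ∃ i : τ.vertex ⟶ m.F.obj γ.vertex, IsIncl i ∧
      ∀ c, τ.app (m.F.obj c) ≫ i = m.F.map (γ.app c)) : σ = τ := by
  obtain ⟨i, hi, ei⟩ := hσ
  obtain ⟨k, hk, ek⟩ := hτ
  obtain ⟨c, hc⟩ := γ.exists_iso
  refine NCone.eq_of_rle (ρ := σ) (a := m.F.obj c) (RLe.refl σ)
    (RClass.of_le_of.1 hR.ge) ?_ i k hi hk ?_
  · exact NCone.isIso_of_comp_incl _ i hi (by rw [ei]; infer_instance)
  · rw [ei, ek]

/-- The map of connection semigroups induced by a CC-morphism `(F, G)`: it sends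
`ε(c, d) * u` to `ε(F c, G d) * F u`. -/
noncomputable def Hom.mapCone {X Y : CC.{u}} (m : X.Hom Y) (γ : X.connSemigroup) :
    Y.connSemigroup :=
  ⟨(m.exists_isImage γ).choose, by
    have := ((m.exists_isImage γ).choose_spec.spec γ.2).1
    change RClass.of _ ∈ Y.D
    rw [this]; exact (m.G _).2⟩

/-- The value of `mapCone` does not depend on the chosen representation `ε(c, d) * u`. -/
theorem Hom.mapCone_eq_iff {X Y : CC.{u}} (m : X.Hom Y) (γ : X.connSemigroup)
    (γ' : NCone Y.carrier) : (m.mapCone γ).1 = γ' ↔ m.IsImage γ.1 γ' := by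
  constructor
  · rintro rfl; exact (m.exists_isImage γ).choose_spec
  · intro h
    have h₁ := (m.exists_isImage γ).choose_spec.spec γ.2
    have h₂ := h.spec γ.2
    exact m.image_unique (h₁.1.trans h₂.1.symm) h₁.2 h₂.2

theorem Hom.mapCone_spec {X Y : CC.{u}} (m : X.Hom Y) (γ : X.connSemigroup) :
    RClass.of (m.mapCone γ).1 = (m.G ⟨RClass.of γ.1, γ.2⟩).1 ∧
    ∃ i : (m.mapCone γ).1.vertex ⟶ m.F.obj γ.1.vertex, IsIncl i ∧
      ∀ c, (m.mapCone γ).1.app (m.F.obj c) ≫ i = m.F.map (γ.1.app c) :=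
  ((m.mapCone_eq_iff γ _).1 rfl).spec γ.2

theorem Hom.mapCone_unique {X Y : CC.{u}} (m : X.Hom Y) (γ : X.connSemigroup)
    (τ : Y.connSemigroup) (h : RClass.of τ.1 = (m.G ⟨RClass.of γ.1, γ.2⟩).1)
    (h' : ∃ i : τ.1.vertex ⟶ m.F.obj γ.1.vertex, IsIncl i ∧
      ∀ c, τ.1.app (m.F.obj c) ≫ i = m.F.map (γ.1.app c)) : m.mapCone γ = τ :=
  Subtype.ext (m.image_unique ((m.mapCone_spec γ).1.trans h.symm) (m.mapCone_spec γ).2 h')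

theorem Hom.mapCone_mul {X Y : CC.{u}} (m : X.Hom Y) (γ δ : X.connSemigroup) :
    m.mapCone (γ * δ) = m.mapCone γ * m.mapCone δ := by
  obtain ⟨hγ, i, hi, ei⟩ := m.mapCone_spec γ
  obtain ⟨-, k, hk, ek⟩ := m.mapCone_spec δ
  obtain ⟨hγδ, l, hl, el⟩ := m.mapCone_spec (γ * δ)
  obtain ⟨c, hc⟩ := γ.1.exists_iso
  refine Subtype.ext (NCone.eq_of_rle (ρ := (m.mapCone γ).1) (a := m.F.obj c)
    (b := m.F.obj δ.1.vertex) ?_ ⟨_, rfl⟩ ?_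
    (l ≫ m.F.map (NCone.mulIncl γ.1 δ.1)) (NCone.mulIncl _ (m.mapCone δ).1 ≫ k) ?_ ?_ ?_)
  · rw [← RClass.of_le_of, hγ, hγδ]
    exact m.G.monotone (a := ⟨_, (γ * δ).2⟩) (b := ⟨_, γ.2⟩)
      (RClass.of_le_of.2 ⟨δ.1, rfl⟩)
  · exact NCone.isIso_of_comp_incl _ i hi (by rw [ei]; infer_instance)
  · exact CategoryWithSubobjects.incl_comp _ _ hl (m.map_incl _ (NCone.isIncl_mulIncl _ _))
  · exact CategoryWithSubobjects.incl_comp _ _ (NCone.isIncl_mulIncl _ _) hk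
  · have h₁ : m.F.map ((γ * δ).1.app c) ≫ m.F.map (NCone.mulIncl γ.1 δ.1) =
        m.F.map (γ.1.app c) ≫ m.F.map (δ.1.app γ.1.vertex) := by
      rw [← Functor.map_comp, ← Functor.map_comp]
      exact congrArg m.F.map (NCone.mul_app γ.1 δ.1 c)
    have h₂ : (m.mapCone γ * m.mapCone δ).1.app (m.F.obj c) ≫
        NCone.mulIncl (m.mapCone γ).1 (m.mapCone δ).1 =
        (m.mapCone γ).1.app (m.F.obj c) ≫ (m.mapCone δ).1.app (m.mapCone γ).1.vertex :=
      NCone.mul_app _ _ _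
    rw [← Category.assoc, el, h₁]
    refine Eq.trans ?_ (Category.assoc _ _ _)
    rw [h₂, ← (m.mapCone δ).1.compat i hi, Category.assoc, Category.assoc, ek,
      ← Category.assoc, ei]

end CC

/-! ### The category of right reductive regular semigroups -/

/-- The property of being a right reductive regular semigroup. -/
def isRRS : ObjectProperty Semigrp.{u} := fun S => RegularSemigroup S ∧ RightReductive S

/-- The category of right reductive regular semigroups and semigroup homomorphisms, as a full
subcategory of the category of semigroups. -/
abbrev RRS : Type (u + 1) := (isRRS.{u}).FullSubcategory

instance (S : RRS.{u}) : RegularSemigroup S.obj := S.property.1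
instance (S : RRS.{u}) : RightReductive S.obj := S.property.2

/-- The functor from connected categories to right reductive regular semigroups: it sends a
connected category to its dual connection semigroup. -/
noncomputable def CC.toRRS : CC.{u} ⥤ RRS.{u} where
  obj X := ⟨Semigrp.of X.dualConnSemigroup, ⟨inferInstance, inferInstance⟩⟩
  map {X Y} m := ObjectProperty.homMk (Semigrp.ofHom
    { toFun := fun γ => MulOpposite.op (CC.Hom.mapCone m γ.unop)
      map_mul' := fun γ δ => by
        rw [MulOpposite.unop_mul, CC.Hom.mapCone_mul, MulOpposite.op_mul] })
  map_id X := by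
    ext γ
    refine congrArg MulOpposite.op (CC.Hom.mapCone_unique _ γ.unop γ.unop rfl ?_)
    exact ⟨𝟙 _, NCone.isIncl_eqToHom rfl, fun c => Category.comp_id _⟩
  map_comp {X Y Z} m n := by
    ext γ
    refine congrArg MulOpposite.op (CC.Hom.mapCone_unique _ γ.unop
      (CC.Hom.mapCone n (CC.Hom.mapCone m γ.unop)) ?_ ?_)
    · obtain ⟨h, -⟩ := CC.Hom.mapCone_spec m γ.unop
      obtain ⟨h', -⟩ := CC.Hom.mapCone_spec n (CC.Hom.mapCone m γ.unop)
      rw [h']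
      exact congrArg (fun d => (CC.Hom.G n d).1) (Subtype.ext h)
    · obtain ⟨-, i, hi, e⟩ := CC.Hom.mapCone_spec m γ.unop
      obtain ⟨-, i', hi', e'⟩ := CC.Hom.mapCone_spec n (CC.Hom.mapCone m γ.unop)
      refine ⟨i' ≫ (CC.Hom.F n).map i, CategoryWithSubobjects.incl_comp _ _ hi'
        (CC.Hom.map_incl n _ hi), fun c => ?_⟩
      have e'' := e' ((CC.Hom.F m).obj c)
      rw [← Category.assoc]
      refine (congrArg (· ≫ (CC.Hom.F n).map i) e'').trans ?_
      rw [← Functor.map_comp, e]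
      rfl

/-! ### The category of principal right ideals -/

section RightCategory

/-- The objects of the right category of `S`: the principal right ideals `e S` with `e`
idempotent. -/
@[ext]
structure RCat (S : Type u) [Semigroup S] : Type u where
  ideal : Set S
  exists_eq : ∃ e : S, IsIdempotentElem e ∧ ideal = {y | ∃ s, y = e * s}

namespace RCat

variable {S : Type u} [Semigroup S]

/-- The morphisms `e S ⟶ f S`: the maps `l(e, u, f)`, sending `x` to `u x`, with
`u ∈ f S e`. -/
@[ext]
structure Hom (X Y : RCat S) where
  toFun : X.ideal → Y.ideal
  exists_eq : ∃ e f u : S, IsIdempotentElem e ∧ X.ideal = {y | ∃ s, y = e * s} ∧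
    IsIdempotentElem f ∧ Y.ideal = {y | ∃ s, y = f * s} ∧ (∃ s, u = f * s * e) ∧
    ∀ x, (toFun x : S) = u * x

theorem mul_mem (X : RCat S) {x : S} (hx : x ∈ X.ideal) (s : S) : x * s ∈ X.ideal := by
  obtain ⟨X, e, he, rfl⟩ := X
  obtain ⟨t, rfl⟩ := hx
  exact ⟨t * s, mul_assoc _ _ _⟩

/-- Left multiplication by `u` as a morphism `X ⟶ Y`, if it maps `X` to `Y`. -/
def lmul {X Y : RCat S} (u : S) (h : ∀ x ∈ X.ideal, u * x ∈ Y.ideal) : Hom X Y where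
  toFun x := ⟨u * x, h x x.2⟩
  exists_eq := by
    obtain ⟨X, e, he, rfl⟩ := X
    obtain ⟨Y, f, hf, rfl⟩ := Y
    obtain ⟨t, ht⟩ := h e ⟨e, he.symm⟩
    refine ⟨e, f, u * e, he, rfl, hf, rfl, ⟨t, ?_⟩, ?_⟩
    · rw [← ht, mul_assoc, he]
    · rintro ⟨x, s, rfl⟩
      change u * (e * s) = u * e * (e * s)
      rw [mul_assoc u e, ← mul_assoc e e, he]

theorem Hom.exists_mul {X Y : RCat S} (f : Hom X Y) :
    ∃ u : S, ∀ x, (f.toFun x : S) = u * x := by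
  obtain ⟨e, g, u, -, -, -, -, -, h⟩ := f.exists_eq
  exact ⟨u, h⟩

/-- The right category of `S`; composition is composition of maps, written in the order of
application. -/
instance : SmallCategory (RCat S) where
  Hom := Hom
  id X :=
    { toFun := id
      exists_eq := by
        obtain ⟨X, e, he, rfl⟩ := X
        refine ⟨e, e, e, he, rfl, he, rfl, ⟨e, by rw [he, he]⟩, ?_⟩
        rintro ⟨x, s, rfl⟩
        change e * s = e * (e * s)
        rw [← mul_assoc, he] }
  comp {X Y Z} f g :=
    { toFun := g.toFun ∘ f.toFun
      exists_eq := by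
        obtain ⟨u, hu⟩ := f.exists_mul
        obtain ⟨v, hv⟩ := g.exists_mul
        have h : ∀ x : X.ideal, ((g.toFun (f.toFun x)) : S) = v * u * x := fun x => by
          rw [hv, hu, mul_assoc]
        obtain ⟨e, e', w, he, hX, he', hY, hw, h'⟩ :=
          (lmul (X := X) (Y := Z) (v * u) (fun x hx => by
            rw [← h ⟨x, hx⟩]; exact Subtype.prop _)).exists_eq
        exact ⟨e, e', w, he, hX, he', hY, hw, fun x => (h x).trans (h' x)⟩ }

/-- The action of a morphism on an element. -/
def ap {X Y : RCat S} (f : X ⟶ Y) : X.ideal → Y.ideal := Hom.toFun f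

theorem hom_ext {X Y : RCat S} {f g : X ⟶ Y} (h : ∀ x, (ap f x : S) = ap g x) : f = g :=
  Hom.ext (funext fun x => Subtype.ext (h x))

theorem ap_id {X : RCat S} (x : X.ideal) : ap (𝟙 X) x = x := rfl

theorem ap_comp {X Y Z : RCat S} (f : X ⟶ Y) (g : Y ⟶ Z) (x : X.ideal) :
    ap (f ≫ g) x = ap g (ap f x) := rfl

/-- Left multiplication by `u`, as a morphism. -/
def mulHom {X Y : RCat S} (u : S) (h : ∀ x ∈ X.ideal, u * x ∈ Y.ideal) : X ⟶ Y := lmul u h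

theorem ap_mulHom {X Y : RCat S} (u : S) (h : ∀ x ∈ X.ideal, u * x ∈ Y.ideal) (x : X.ideal) :
    (ap (mulHom u h) x : S) = u * x := rfl

theorem exists_mul {X Y : RCat S} (f : X ⟶ Y) : ∃ u : S, ∀ x, (ap f x : S) = u * x :=
  Hom.exists_mul f

theorem exists_idem (X : RCat S) :
    ∃ e : S, IsIdempotentElem e ∧ e ∈ X.ideal ∧ ∀ x ∈ X.ideal, e * x = x := by
  obtain ⟨X, e, he, rfl⟩ := X
  refine ⟨e, he, ⟨e, he.symm⟩, ?_⟩
  rintro _ ⟨s, rfl⟩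
  rw [← mul_assoc, he]

/-- The inclusions of the right category are the inclusion maps of principal right ideals. -/
instance : CategoryWithSubobjects (RCat S) where
  incl := fun _ _ f => ∀ x, (ap f x : S) = x
  incl_id _ _ := rfl
  incl_comp f g hf hg x := by rw [ap_comp, hg, hf]
  incl_unique f g hf hg := hom_ext fun x => by rw [hf, hg]
  incl_antisymm f g hf hg := RCat.ext (Set.Subset.antisymm
    (fun x hx => by have := (ap f ⟨x, hx⟩).2; rwa [hf] at this)
    (fun x hx => by have := (ap g ⟨x, hx⟩).2; rwa [hg] at this))
  incl_mono f hf := ⟨fun g h e => hom_ext fun x => by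
    have := congrArg (fun k => (ap k x : S)) e
    simpa only [ap_comp, hf] using this⟩
  incl_of_comp h g hc hg x := by rw [← hg, ← ap_comp, hc]

/-- The inclusion map of a principal right ideal into a larger one. -/
noncomputable def inclHom {X Y : RCat S} (h : X.ideal ⊆ Y.ideal) : X ⟶ Y :=
  mulHom (exists_idem X).choose fun x hx => by
    rw [(exists_idem X).choose_spec.2.2 x hx]; exact h hx

theorem ap_inclHom {X Y : RCat S} (h : X.ideal ⊆ Y.ideal) (x : X.ideal) : (ap (inclHom h) x : S) = x :=
  (exists_idem X).choose_spec.2.2 x x.2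

theorem isIso_of {X Y : RCat S} (f : X ⟶ Y) (g : Y ⟶ X) (h : ∀ x, (ap g (ap f x) : S) = x)
    (h' : ∀ y, (ap f (ap g y) : S) = y) : IsIso f :=
  ⟨g, hom_ext h, hom_ext h'⟩

theorem ap_eqToHom {X Y : RCat S} (h : X = Y) (x : X.ideal) : (ap (eqToHom h) x : S) = x := by
  subst h
  rfl

variable {S' S'' : Type u} [Semigroup S'] [Semigroup S'']


/-- The object map of the functor induced by a homomorphism `φ`: it sends `e S` to
`φ(e) S'`. -/
def mapObj (φ : S →ₙ* S') (X : RCat S) : RCat S' :=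
  ⟨{y | ∃ x ∈ X.ideal, ∃ s, y = φ x * s}, by
    obtain ⟨e, he, heX, h⟩ := exists_idem X
    refine ⟨φ e, he.map φ, Set.ext fun y => ⟨?_, ?_⟩⟩
    · rintro ⟨x, hx, s, rfl⟩
      exact ⟨φ x * s, by rw [← mul_assoc, ← map_mul, h x hx]⟩
    · rintro ⟨s, rfl⟩
      exact ⟨e, heX, s, rfl⟩⟩

theorem map_mul_mem (φ : S →ₙ* S') {X Y : RCat S} (f : X ⟶ Y) {u : S}
    (hu : ∀ x, (ap f x : S) = u * x) (y : S') (hy : y ∈ (mapObj φ X).ideal) :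
    φ u * y ∈ (mapObj φ Y).ideal := by
  obtain ⟨x, hx, s, rfl⟩ := hy
  refine ⟨u * x, ?_, s, by rw [map_mul, mul_assoc]⟩
  have := (ap f ⟨x, hx⟩).2
  rwa [hu] at this

/-- The functor induced by a homomorphism `φ`: it sends `l(e, u, f)` to
`l(φ e, φ u, φ f)`. -/
noncomputable def mapHom (φ : S →ₙ* S') {X Y : RCat S} (f : X ⟶ Y) :
    mapObj φ X ⟶ mapObj φ Y :=
  mulHom (φ (exists_mul f).choose) (map_mul_mem φ f (exists_mul f).choose_spec)

/-- The value of `mapHom` does not depend on the element `u` that represents the morphism. -/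
theorem ap_mapHom (φ : S →ₙ* S') {X Y : RCat S} (f : X ⟶ Y) {u : S}
    (hu : ∀ x, (ap f x : S) = u * x) (y : (mapObj φ X).ideal) :
    (ap (mapHom φ f) y : S') = φ u * y := by
  obtain ⟨_, x, hx, s, rfl⟩ := y
  change φ _ * (φ x * s) = φ u * (φ x * s)
  rw [← mul_assoc, ← mul_assoc, ← map_mul, ← map_mul,
    ← (exists_mul f).choose_spec ⟨x, hx⟩, ← hu ⟨x, hx⟩]

/-- The functor between right categories induced by a homomorphism. -/
noncomputable def mapFunctor (φ : S →ₙ* S') : RCat S ⥤ RCat S' where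
  obj := mapObj φ
  map := mapHom φ
  map_id X := hom_ext fun y => by
    obtain ⟨e, he, heX, h⟩ := exists_idem X
    obtain ⟨_, x, hx, s, rfl⟩ := y
    rw [ap_mapHom φ (𝟙 X) (u := e) fun x => by rw [ap_id, h x x.2], ap_id]
    change φ e * (φ x * s) = φ x * s
    rw [← mul_assoc, ← map_mul, h x hx]
  map_comp f g := hom_ext fun y => by
    obtain ⟨u, hu⟩ := exists_mul f
    obtain ⟨v, hv⟩ := exists_mul g
    rw [ap_comp, ap_mapHom φ g hv, ap_mapHom φ f hu,
      ap_mapHom φ (f ≫ g) (u := v * u) fun x => by rw [ap_comp, hv, hu, mul_assoc],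
      map_mul, mul_assoc]

theorem mapFunctor_id : mapFunctor (MulHom.id S) = 𝟭 (RCat S) := by
  refine CategoryTheory.Functor.ext (fun X => ?_) fun X Y f => ?_
  · refine RCat.ext (Set.ext fun y => ⟨?_, ?_⟩)
    · rintro ⟨x, hx, s, rfl⟩
      exact X.mul_mem hx s
    · intro hy
      obtain ⟨e, he, heX, h⟩ := X.exists_idem
      exact ⟨e, heX, y, (h y hy).symm⟩
  · obtain ⟨u, hu⟩ := exists_mul f
    refine hom_ext fun y => (ap_mapHom _ f hu y).trans ?_
    rw [ap_comp, ap_comp, ap_eqToHom]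
    refine Eq.trans ?_ (hu _).symm
    rw [ap_eqToHom]
    rfl

theorem mapFunctor_comp (φ : S →ₙ* S') (ψ : S' →ₙ* S'') :
    mapFunctor (ψ.comp φ) = mapFunctor φ ⋙ mapFunctor ψ := by
  refine CategoryTheory.Functor.ext (fun X => ?_) fun X Y f => ?_
  · refine RCat.ext (Set.ext fun y => ⟨?_, ?_⟩)
    · rintro ⟨x, hx, s, rfl⟩
      obtain ⟨e, he, heX, h⟩ := X.exists_idem
      refine ⟨φ e, ⟨e, heX, φ e, ?_⟩, ψ (φ x) * s, ?_⟩
      · rw [← map_mul, he]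
      · rw [← mul_assoc, ← map_mul, ← map_mul, h x hx]
        rfl
    · rintro ⟨_, ⟨x, hx, t, rfl⟩, s, rfl⟩
      refine ⟨x, hx, ψ t * s, ?_⟩
      rw [map_mul, mul_assoc]
      rfl
  · obtain ⟨u, hu⟩ := exists_mul f
    refine hom_ext fun y => (ap_mapHom _ f hu y).trans ?_
    rw [ap_comp, ap_comp, ap_eqToHom]
    refine Eq.trans ?_ (ap_mapHom ψ (mapHom φ f) (ap_mapHom φ f hu) _).symm
    rw [ap_eqToHom]
    rfl

variable [RegularSemigroup S]

/-- The principal right ideal `a S` of a regular semigroup; it equals `f S` for every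
idempotent `f` in the `R`-class of `a`. -/
def principal (a : S) : RCat S :=
  ⟨{y | ∃ s, y = a * s}, by
    obtain ⟨x, hx, -⟩ := RegularSemigroup.exists_inverse a
    refine ⟨a * x, ?_, ?_⟩
    · change a * x * (a * x) = a * x
      rw [← mul_assoc, hx]
    · ext y
      constructor
      · rintro ⟨s, rfl⟩
        exact ⟨a * s, by rw [← mul_assoc, hx]⟩
      · rintro ⟨s, rfl⟩
        exact ⟨x * s, mul_assoc _ _ _⟩⟩

theorem mem_principal (a : S) : a ∈ (principal a).ideal := by
  obtain ⟨x, hx, -⟩ := RegularSemigroup.exists_inverse a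
  exact ⟨x * a, by rw [← mul_assoc, hx]⟩

theorem mul_mem_principal (a s : S) : a * s ∈ (principal a).ideal := ⟨s, rfl⟩

theorem principal_subset {X : RCat S} {a : S} (h : a ∈ X.ideal) :
    (principal a).ideal ⊆ X.ideal := by
  rintro _ ⟨s, rfl⟩
  exact X.mul_mem h s

theorem eq_principal {X : RCat S} {e : S} (he : e ∈ X.ideal) (h : ∀ x ∈ X.ideal, e * x = x) :
    principal e = X :=
  RCat.ext (Set.Subset.antisymm (principal_subset he)
    fun x hx => ⟨x, (h x hx).symm⟩)

/-- The principal cone `l^a`: its vertex is `a S` and its component at `X = e S` is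
`x ↦ a x`, i.e. `l(e, a e, f)` for `f` an idempotent in the `R`-class of `a`. -/
def lcone (a : S) : NCone (RCat S) where
  vertex := principal a
  app X := mulHom a fun x _ => mul_mem_principal _ x
  compat j hj := hom_ext fun x => by
    rw [ap_comp, ap_mulHom, ap_mulHom, hj]
  exists_iso := by
    obtain ⟨x, hx, -⟩ := RegularSemigroup.exists_inverse a
    refine ⟨principal (x * a), isIso_of _ (mulHom x ?_) ?_ ?_⟩
    · rintro _ ⟨s, rfl⟩
      rw [← mul_assoc]
      exact mul_mem_principal _ s
    · rintro ⟨_, s, rfl⟩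
      rw [ap_mulHom, ap_mulHom]
      simp only [← mul_assoc]
      rw [mul_assoc x a x, mul_assoc x, hx]
    · rintro ⟨_, s, rfl⟩
      rw [ap_mulHom, ap_mulHom]
      simp only [← mul_assoc]
      rw [hx]

theorem ap_lcone (a : S) {X : RCat S} (x : X.ideal) : (ap ((lcone a).app X) x : S) = a * x := rfl

instance : NormalCategory (RCat S) where
  incl_split {X Y} j hj := by
    obtain ⟨e, he, heX, h⟩ := exists_idem X
    refine ⟨mulHom e fun y _ => X.mul_mem heX y, hom_ext fun x => ?_⟩
    rw [ap_comp, ap_mulHom, hj, h x x.2, ap_id]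
  exists_normalFactorisation {X Y} f := by
    obtain ⟨e, he, heX, h⟩ := exists_idem X
    obtain ⟨u', hu'⟩ := exists_mul f
    obtain ⟨u, hue, hu⟩ : ∃ u, u * e = u ∧ ∀ x, (ap f x : S) = u * x :=
      ⟨u' * e, by rw [mul_assoc, he], fun x => by rw [hu', mul_assoc, h x x.2]⟩
    have huY : u ∈ Y.ideal := by
      have := (ap f ⟨e, heX⟩).2
      rwa [hu, hue] at this
    obtain ⟨w, hw, -⟩ := RegularSemigroup.exists_inverse u
    have huew : u * (e * w * u) = u := by
      rw [← mul_assoc, ← mul_assoc, hue, hw]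
    have hgX : (principal (e * w * u)).ideal ⊆ X.ideal :=
      principal_subset (by rw [mul_assoc]; exact X.mul_mem heX _)
    have hg : ∀ s, e * w * u * (e * w * u * s) = e * w * u * s := fun s => by
      rw [← mul_assoc, mul_assoc (e * w) u, huew]
    refine ⟨principal (e * w * u), principal u, mulHom (e * w * u) (fun x _ => mul_mem_principal _ x),
      mulHom u (fun x _ => mul_mem_principal _ x), inclHom (principal_subset huY),
      ⟨inclHom hgX, ap_inclHom hgX, ?_⟩,
      isIso_of _ (mulHom (e * w) ?_) ?_ ?_, ap_inclHom _, ?_⟩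
    · refine hom_ext ?_
      rintro ⟨_, s, rfl⟩
      rw [ap_comp, ap_mulHom, ap_inclHom, ap_id, hg]
    · rintro _ ⟨s, rfl⟩
      rw [← mul_assoc]
      exact mul_mem_principal _ s
    · rintro ⟨_, s, rfl⟩
      rw [ap_mulHom, ap_mulHom, ← mul_assoc, hg]
    · rintro ⟨_, s, rfl⟩
      rw [ap_mulHom, ap_mulHom]
      rw [← mul_assoc (e * w) u s, ← mul_assoc, huew]
    · refine hom_ext fun x => ?_
      rw [ap_comp, ap_comp, ap_inclHom, ap_mulHom, ap_mulHom, hu, ← mul_assoc, huew]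
  exists_cone X := by
    obtain ⟨e, he, heX, h⟩ := exists_idem X
    have hX := eq_principal heX h
    subst hX
    refine ⟨lcone e, rfl, hom_ext fun x => ?_⟩
    rw [ap_lcone, ap_id]
    exact h x x.2

theorem lcone_mul (a b : S) : lcone a * lcone b = lcone (b * a) := by
  have h : (lcone (b * a)).vertex.ideal ⊆ (lcone b).vertex.ideal :=
    principal_subset (mul_mem_principal b a)
  refine (NCone.eq_mul (σ := lcone (b * a)) (inclHom h) (ap_inclHom h) fun X => ?_).symm
  refine hom_ext fun x => ?_
  rw [ap_comp, ap_inclHom, ap_comp, ap_lcone, ap_lcone, ap_lcone, mul_assoc]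

theorem lcone_idem {e : S} (he : IsIdempotentElem e) : IsIdempotentElem (lcone e) := by
  change lcone e * lcone e = lcone e
  rw [lcone_mul, he]

theorem eq_lcone_of_rle {γ : NCone (RCat S)} {a : S} (h : RLe γ (lcone a)) :
    ∃ u, γ = lcone (u * a) := by
  obtain ⟨δ, rfl⟩ := h
  obtain ⟨u, hu⟩ := exists_mul (δ.app (lcone a).vertex)
  have h : (lcone (u * a)).vertex.ideal ⊆ δ.vertex.ideal := by
    refine principal_subset ?_
    have := (ap (δ.app (lcone a).vertex) ⟨a, mem_principal a⟩).2
    rwa [hu] at this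
  refine ⟨u, (NCone.eq_mul (σ := lcone (u * a)) (inclHom h) (ap_inclHom h) fun X => ?_).symm⟩
  refine hom_ext fun x => ?_
  rw [ap_comp, ap_inclHom, ap_comp, ap_lcone, hu, ap_lcone, mul_assoc]

theorem lcone_rle_of_eq {a b u : S} (h : a = u * b) : RLe (lcone a) (lcone b) :=
  ⟨lcone u, by rw [lcone_mul, h]⟩

theorem of_lcone_eq_idem (a : S) : ∃ e, IsIdempotentElem e ∧
    RClass.of (lcone a) = RClass.of (lcone e) := by
  obtain ⟨x, hx, -⟩ := RegularSemigroup.exists_inverse a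
  refine ⟨x * a, ?_, le_antisymm (lcone_rle_of_eq (u := a) ?_) (lcone_rle_of_eq rfl)⟩
  · change x * a * (x * a) = x * a
    rw [mul_assoc, ← mul_assoc a, hx]
  · rw [← mul_assoc, hx]

variable (S) in
/-- The down-set of the classes of the principal cones `l^e`, `e` idempotent. (An `R`-class of
the semigroup of cones is an `L`-class of the opposite semigroup.) -/
def lclasses : LowerSet (RClass (NCone (RCat S))) where
  carrier := {d | ∃ e : S, IsIdempotentElem e ∧ d = RClass.of (lcone e)}
  lower' := by
    rintro _ d hd ⟨e, he, rfl⟩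
    obtain ⟨γ, rfl⟩ := d.exists_of
    obtain ⟨u, rfl⟩ := eq_lcone_of_rle (RClass.of_le_of.1 hd)
    exact of_lcone_eq_idem _

variable (S) in
/-- The right category of a regular semigroup, connected by the classes of its principal
cones. -/
def toCC : CC.{u} where
  carrier := RCat S
  D := lclasses S
  connected X := by
    obtain ⟨e, he, heX, h⟩ := exists_idem X
    exact ⟨_, ⟨e, he, rfl⟩, lcone e, lcone_idem he, eq_principal heX h, rfl⟩

theorem lcone_injective [RightReductive S] {a b : S} (h : lcone a = lcone b) : a = b := by
  refine RightReductive.injective (funext fun x => ?_)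
  have key : ∀ γ : NCone (RCat S), γ = lcone b →
      (ap (γ.app (principal x)) ⟨x, mem_principal x⟩ : S) = b * x := by
    rintro _ rfl
    rfl
  exact (key _ h : a * x = b * x)

theorem exists_of_lcone_le [RightReductive S] {a b : S} (h : RLe (lcone a) (lcone b)) :
    ∃ u, a = u * b := by
  obtain ⟨u, h⟩ := eq_lcone_of_rle h
  exact ⟨u, lcone_injective h⟩

variable [RegularSemigroup S']

theorem mapObj_principal (φ : S →ₙ* S') (a : S) : mapObj φ (principal a) = principal (φ a) := by
  refine RCat.ext (Set.ext fun y => ⟨?_, ?_⟩)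
  · rintro ⟨_, ⟨s, rfl⟩, t, rfl⟩
    exact ⟨φ s * t, by rw [map_mul, mul_assoc]⟩
  · rintro ⟨t, rfl⟩
    exact ⟨a, mem_principal a, t, rfl⟩

variable [RightReductive S]

theorem map_class_le (φ : S →ₙ* S') {a b : S}
    (h : RClass.of (lcone a) ≤ RClass.of (lcone b)) :
    RClass.of (lcone (φ a)) ≤ RClass.of (lcone (φ b)) := by
  obtain ⟨u, rfl⟩ := exists_of_lcone_le (RClass.of_le_of.1 h)
  exact RClass.of_le_of.2 (lcone_rle_of_eq (map_mul φ u b))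

/-- The map of down-sets induced by a homomorphism `φ`: it sends the class of `l^e` to the
class of `l^(φ e)`. -/
noncomputable def mapClass (φ : S →ₙ* S') : lclasses S →o lclasses S' where
  toFun d := ⟨RClass.of (lcone (φ d.2.choose)), φ d.2.choose,
    d.2.choose_spec.1.map φ, rfl⟩
  monotone' d d' h := map_class_le φ (by
    rw [← d.2.choose_spec.2, ← d'.2.choose_spec.2]; exact h)

/-- The value of `mapClass` does not depend on the element `a` that represents the class. -/
theorem mapClass_eq (φ : S →ₙ* S') (d : lclasses S) {a : S}
    (h : RClass.of (lcone a) = d.1) : (mapClass φ d).1 = RClass.of (lcone (φ a)) := by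
  have e := h.trans d.2.choose_spec.2
  exact le_antisymm (map_class_le φ e.ge) (map_class_le φ e.le)

/-- The CC-morphism induced by a homomorphism. -/
noncomputable def mapCC (φ : S →ₙ* S') : toCC S ⟶ toCC S' where
  F := mapFunctor φ
  map_incl {X Y} j hj y := by
    obtain ⟨e, he, heX, h⟩ := exists_idem X
    refine (ap_mapHom φ j (u := e) (fun x => ?_) y).trans ?_
    · rw [h x x.2, hj]
    · obtain ⟨_, x, hx, s, rfl⟩ := y
      change φ e * (φ x * s) = φ x * s
      rw [← mul_assoc, ← map_mul, h x hx]
  G := mapClass φ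
  map_connected := by
    rintro c d ⟨ε, hε, rfl, hd⟩
    obtain ⟨e, he, hde⟩ := d.2
    obtain ⟨u, rfl⟩ := eq_lcone_of_rle (RClass.of_le_of.1 (hd.trans hde).le)
    have hu : IsIdempotentElem (u * e) := lcone_injective ((lcone_mul _ _).symm.trans hε)
    exact ⟨lcone (φ (u * e)), lcone_idem (hu.map φ), (mapObj_principal φ _).symm,
      (mapClass_eq φ d hd).symm⟩
  map_app := by
    rintro d ε ε' hε hd hε' hd' hv X
    obtain ⟨e, he, hde⟩ := d.2
    obtain ⟨u, rfl⟩ := eq_lcone_of_rle (RClass.of_le_of.1 (hd.trans hde).le)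
    have hu : IsIdempotentElem (u * e) := lcone_injective ((lcone_mul _ _).symm.trans hε)
    have h' : ε' = lcone (φ (u * e)) := NCone.idem_unique hε' (lcone_idem (hu.map φ))
      (RClass.of_le_of.1 (hd'.trans (mapClass_eq φ d hd)).le)
      (hv.trans (mapObj_principal φ _))
    subst h'
    refine hom_ext fun y => (ap_eqToHom _ _).trans ?_
    exact ap_mapHom φ _ (fun x => ap_lcone (u * e) x) y

end RCat

end RightCategory

theorem CC.hom_ext {X Y : CC.{u}} {m n : X ⟶ Y} (hF : CC.Hom.F m = CC.Hom.F n)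
    (hG : ∀ d, CC.Hom.G m d = CC.Hom.G n d) : m = n :=
  CC.Hom.ext hF (OrderHom.ext _ _ (funext hG))

/-- The functor from right reductive regular semigroups to connected categories: it sends a
semigroup to its right category, connected by the classes of its principal cones. -/
noncomputable def RRS.toCC : RRS.{u} ⥤ CC.{u} where
  obj S := RCat.toCC S.obj
  map φ := RCat.mapCC φ.hom.hom
  map_id S := CC.hom_ext RCat.mapFunctor_id fun d => Subtype.ext d.2.choose_spec.2.symm
  map_comp {S S' S''} φ ψ := by
    refine CC.hom_ext (RCat.mapFunctor_comp φ.hom.hom ψ.hom.hom) fun d => Subtype.ext ?_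
    have h := d.2.choose_spec.2.symm
    refine (RCat.mapClass_eq _ d h).trans ?_
    exact (RCat.mapClass_eq ψ.hom.hom (RCat.mapClass φ.hom.hom d)
      (RCat.mapClass_eq φ.hom.hom d h).symm).symm

end ConnCat

namespace ConnCat

/-! ### The unit: a semigroup is the dual connection semigroup of its right category -/

namespace RCat

variable {S S' : Type u} [Semigroup S] [RegularSemigroup S] [Semigroup S'] [RegularSemigroup S']

/-! Both round trips are naturally isomorphic to the identity, and on both sides the comparison map
is explicit.

For a semigroup $S$ the map is $a \mapsto l^a$. Since $l^a \cdot l^b = l^{ba}$, it is a homomorphism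
into the opposite of the cone semigroup. Right reductivity is exactly its injectivity. A cone
$\gamma \leqslant_r l^e$ has the form $l^e \cdot \delta$. The component of $\delta$ at $eS$ is left
multiplication by some $u$, so $\gamma = l^{ue}$: the chosen down-set cuts out exactly the principal
cones (`lconeHom_bijective`).

For a connected category $X$ with dual connection semigroup $T$, an object $c$ goes to the set of
cones with vertex below $c$. If $\epsilon$ is an idempotent cone with vertex $c$, then
$\gamma\epsilon = \gamma$ precisely for these $\gamma$, so the set is the principal right ideal of
$T$ generated by $\epsilon$. A morphism $f$ out of $c$ goes to right multiplication by any cone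
$\rho$ whose component at $c$ is $f$ up to an inclusion. Only that component matters (`mul_eq_mul`),
and $f$ is recovered from the value at $\epsilon$ (`exists_eq_of_ap_mapIdeal`). This gives a fully
faithful functor, bijective on objects, which preserves and reflects inclusions. On classes, the
order of $\mathfrak D$ agrees with that of the principal cones of $T$ (`of_lcone_op_le`). Hence the
comparison is an isomorphism in `CC`, not merely an equivalence of underlying categories.

Both naturality statements rest on the fact that `mapCone` is determined by its class and by its
components on the image of $F$. -/

theorem of_lcone_mem_lclasses (a : S) : RClass.of (lcone a) ∈ lclasses S :=
  of_lcone_eq_idem a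

/-- The homomorphism `a ↦ l^a` from `S` to the dual connection semigroup of its right
category. -/
noncomputable def lconeHom (S : Type u) [Semigroup S] [RegularSemigroup S] :
    S →ₙ* (toCC S).dualConnSemigroup where
  toFun a := MulOpposite.op ⟨lcone a, of_lcone_mem_lclasses a⟩
  map_mul' a b := MulOpposite.unop_injective (Subtype.ext (lcone_mul b a).symm)

/-- Injectivity is right reductivity, read off the components of the cones. For surjectivity, a cone
in the class of some $l^e$ is a right multiple of $l^e$, hence itself principal. -/
theorem lconeHom_bijective [RightReductive S] : Function.Bijective (lconeHom S) := by
  constructor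
  · intro a b h
    exact lcone_injective (congrArg (fun γ => γ.unop.1) h)
  · rintro ⟨γ, e, he, hγ⟩
    obtain ⟨u, rfl⟩ := eq_lcone_of_rle (RClass.of_le_of.1 hγ.le)
    exact ⟨u * e, rfl⟩

/-- This is naturality of the unit. By `mapCone_unique` it suffices to compare classes and
components on the image of the functor, and there both cones act as left multiplication by
$\phi(a)$. -/
theorem mapCone_lcone [RightReductive S] (φ : S →ₙ* S') (a : S) :
    CC.Hom.mapCone (mapCC φ) ⟨lcone a, of_lcone_mem_lclasses a⟩ =
      ⟨lcone (φ a), of_lcone_mem_lclasses (φ a)⟩ := by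
  refine CC.Hom.mapCone_unique _ _ _ (mapClass_eq φ _ rfl).symm
    ⟨eqToHom (mapObj_principal φ a).symm, NCone.isIncl_eqToHom _, fun X => hom_ext fun y => ?_⟩
  refine (ap_eqToHom _ _).trans ?_
  exact (ap_mapHom φ _ (fun x => ap_lcone a x) y).symm

end RCat

/-- The isomorphism of a right reductive regular semigroup with the dual connection semigroup of
its right category. -/
noncomputable def RRS.lconeIso (S : RRS.{u}) : S ≅ CC.toRRS.obj (RRS.toCC.obj S) :=
  isRRS.isoMk (MulEquiv.toSemigrpIso (Y := (RCat.toCC S.obj).dualConnSemigroup)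
    (MulEquiv.ofBijective (RCat.lconeHom S.obj) RCat.lconeHom_bijective))

/-- The isomorphisms `S ≅ S(C(S))` are natural. -/
noncomputable def unitNatIso : 𝟭 RRS.{u} ≅ RRS.toCC ⋙ CC.toRRS :=
  NatIso.ofComponents RRS.lconeIso fun {S S'} φ => by
    ext a
    exact (congrArg MulOpposite.op (RCat.mapCone_lcone φ.hom.hom a)).symm

/-! ### Isomorphisms of connected categories -/

theorem NCone.app_eq_of_eq {C : Type u} [SmallCategory C] [CategoryWithSubobjects C]
    (γ : NCone C) {a b : C} (h : a = b) : γ.app a = eqToHom h ≫ γ.app b :=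
  (γ.compat _ (isIncl_eqToHom h)).symm

namespace CC

/-- The strict inverse of a fully faithful functor which is bijective on objects. -/
noncomputable def strictInverse {C D : Type u} [SmallCategory C] [SmallCategory D] (F : C ⥤ D)
    [F.Full] [F.Faithful] (s : D → C) (hs : ∀ y, F.obj (s y) = y) : D ⥤ C where
  obj := s
  map {x y} f := F.preimage (eqToHom (hs x) ≫ f ≫ eqToHom (hs y).symm)
  map_id x := F.map_injective (by simp)
  map_comp f g := F.map_injective (by simp)

theorem map_strictInverse_map {C D : Type u} [SmallCategory C] [SmallCategory D] (F : C ⥤ D)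
    [F.Full] [F.Faithful] (s : D → C) (hs : ∀ y, F.obj (s y) = y) {x y : D} (f : x ⟶ y) :
    F.map ((strictInverse F s hs).map f) = eqToHom (hs x) ≫ f ≫ eqToHom (hs y).symm :=
  F.map_preimage _

/-- A CC-morphism `(F, G)` is an isomorphism if `F` is bijective on objects, fully faithful and
reflects inclusions, `G` is surjective and reflects the order, and `(F, G)` reflects connection. -/
theorem isIso_of {X Y : CC.{u}} (m : X ⟶ Y) [m.F.Full] [m.F.Faithful]
    (hobj : Function.Bijective m.F.obj)
    (hincl : ∀ {a b : X.carrier} (j : a ⟶ b), IsIncl (m.F.map j) → IsIncl j)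
    (hG : Function.Surjective m.G) (hle : ∀ d d', m.G d ≤ m.G d' → d ≤ d')
    (hconn : ∀ c (d : X.D), ConnectedBy (m.F.obj c) (m.G d).1 → ConnectedBy c d.1) :
    IsIso m := by
  obtain ⟨s, hs⟩ := hobj.2.hasRightInverse
  obtain ⟨t, ht⟩ := hG.hasRightInverse
  -- The chosen sections are two-sided inverses: on objects by injectivity, on classes because
  -- reflecting a partial order forces injectivity.
  have hs' : ∀ c, s (m.F.obj c) = c := fun c => hobj.1 (hs _)
  have ht' : ∀ d, t (m.G d) = d := fun d =>
    le_antisymm (hle _ _ (ht _).le) (hle _ _ (ht _).ge)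
  let n : Y ⟶ X :=
    { F := strictInverse m.F s hs
      map_incl := fun j hj => hincl _ (by
        rw [map_strictInverse_map]
        exact CategoryWithSubobjects.incl_comp _ _ (NCone.isIncl_eqToHom _)
          (CategoryWithSubobjects.incl_comp _ _ hj (NCone.isIncl_eqToHom _)))
      G := ⟨t, fun d d' h => hle _ _ (by rwa [ht, ht])⟩
      map_connected := fun c d h => hconn _ _ (by
        change ConnectedBy (m.F.obj (s c)) (m.G (t d)).1
        rwa [hs, ht])
      map_app := fun d ε ε' hε hd hε' hd' hv c => m.F.map_injective (by
        change ε'.vertex = s ε.vertex at hv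
        -- The condition for the inverse is the condition for `m` with the two idempotent cones
        -- exchanged; what remains is transport along `hs` and `hv`.
        have e := m.map_app (t d) ε' ε hε' hd' hε (by rw [ht, hd])
          (by rw [hv, hs]) (s c)
        rw [ε.app_eq_of_eq (hs c)] at e
        rw [Functor.map_comp, map_strictInverse_map, eqToHom_map]
        change (eqToHom (hs c) ≫ ε.app c ≫ eqToHom (hs ε.vertex).symm) ≫
          eqToHom (congrArg m.F.obj hv.symm) = m.F.map (ε'.app (s c))
        rw [← cancel_mono (eqToHom ((congrArg m.F.obj hv).trans (hs ε.vertex))), e]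
        simp) }
  refine ⟨n, ?_, ?_⟩
  · refine CC.hom_ext (CategoryTheory.Functor.ext hs' fun c c' f => m.F.map_injective ?_) ht'
    have e : m.F.map (eqToHom (hs' c) ≫ f ≫ eqToHom (hs' c').symm) =
        eqToHom (hs _) ≫ m.F.map f ≫ eqToHom (hs _).symm := by
      simp only [Functor.map_comp, eqToHom_map]
    exact (map_strictInverse_map m.F s hs (m.F.map f)).trans e.symm
  · exact CC.hom_ext (CategoryTheory.Functor.ext hs fun c c' f => map_strictInverse_map m.F s hs f) ht

end CC

/-! ### The counit: a connected category is the right category of its dual connection semigroup -/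

namespace NCone

variable {C : Type u} [SmallCategory C] [CategoryWithSubobjects C] [NormalCategory C]

/-- An idempotent cone is a right identity for the cones whose vertex is below its own. -/
theorem mul_idem_eq {γ ε : NCone C} (hε : IsIdempotentElem ε) (i : γ.vertex ⟶ ε.vertex)
    (hi : IsIncl i) : γ * ε = γ :=
  (eq_mul i hi fun c => by
    rw [← ε.compat i hi, app_vertex_of_idem hε, Category.comp_id]).symm

end NCone

namespace CC

open MulOpposite

/-! ### Cones representing morphisms, and the ideals attached to objects -/

variable (X : CC.{u})

theorem exists_idem (c : X.carrier) :
    ∃ ε : X.connSemigroup, IsIdempotentElem ε ∧ ε.1.vertex = c := by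
  obtain ⟨d, hd, ε, hε, hv, rfl⟩ := X.connected c
  exact ⟨⟨ε, hd⟩, Subtype.ext hε, hv⟩

/-- Every morphism is a component of a cone of the connection semigroup, up to an inclusion. -/
theorem exists_cone_app {c c' : X.carrier} (f : c ⟶ c') :
    ∃ (ρ : X.connSemigroup) (i : ρ.1.vertex ⟶ c'), IsIncl i ∧ ρ.1.app c ≫ i = f := by
  obtain ⟨d, hd, ε, hε, rfl, rfl⟩ := X.connected c
  -- The witness is $\epsilon * f^\circ$. It lies $\leqslant_r$-below $\epsilon$, so the down-set
  -- condition keeps it in the connection semigroup, and its component at $c$ is $f^\circ$ because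
  -- $\epsilon(c) = 1$.
  refine ⟨⟨ε.star (epiPart f) inferInstance, X.D.lower (RClass.of_le_of.2 (NCone.star_rle hε _ _))
    hd⟩, imIncl f, (canonicalFactorisation_spec f).2.1, ?_⟩
  change (ε.app ε.vertex ≫ epiPart f) ≫ imIncl f = f
  rw [NCone.app_vertex_of_idem hε, Category.id_comp]
  exact (canonicalFactorisation_spec f).2.2.symm

variable {X}

/-- Two cones of the connection semigroup with components at `c` that agree up to inclusions have
the same products with the cones whose vertex is below `c`. -/
theorem mul_eq_mul {γ ρ σ : X.connSemigroup} {c c' : X.carrier} {k : γ.1.vertex ⟶ c}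
    (hk : IsIncl k) {i : ρ.1.vertex ⟶ c'} (hi : IsIncl i) {j : σ.1.vertex ⟶ c'} (hj : IsIncl j)
    (h : ρ.1.app c ≫ i = σ.1.app c ≫ j) : γ * ρ = γ * σ := by
  refine Subtype.ext (NCone.eq_of_incl (NCone.mulIncl γ.1 ρ.1 ≫ i) (NCone.mulIncl γ.1 σ.1 ≫ j)
    (CategoryWithSubobjects.incl_comp _ _ (NCone.isIncl_mulIncl _ _) hi)
    (CategoryWithSubobjects.incl_comp _ _ (NCone.isIncl_mulIncl _ _) hj) fun b => ?_)
  have h₁ := NCone.mul_app γ.1 ρ.1 b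
  have h₂ := NCone.mul_app γ.1 σ.1 b
  refine (Category.assoc _ _ _).symm.trans (Eq.trans ?_ (Category.assoc _ _ _))
  refine (congrArg (· ≫ i) h₁).trans (Eq.trans ?_ (congrArg (· ≫ j) h₂).symm)
  -- The products involve only the components at the vertex of $\gamma$, and these factor through
  -- the components at $c$ via the inclusion `k`.
  simp only [← ρ.1.compat k hk, ← σ.1.compat k hk, Category.assoc, h]

/-- The principal right ideal of the dual connection semigroup that corresponds to an object `c`:
the cones whose vertex is below `c`. -/
def objIdeal (c : X.carrier) : RCat X.dualConnSemigroup where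
  ideal := {γ | ∃ i : γ.unop.1.vertex ⟶ c, IsIncl i}
  exists_eq := by
    obtain ⟨ε, hε, rfl⟩ := X.exists_idem c
    -- The generator is any idempotent cone with vertex $c$: it fixes every cone with vertex below
    -- $c$, and every product ending in it has vertex below $c$.
    refine ⟨op ε, congrArg op hε, Set.ext fun γ => ⟨?_, ?_⟩⟩
    · rintro ⟨i, hi⟩
      exact ⟨γ, unop_injective (Subtype.ext
        (NCone.mul_idem_eq (congrArg Subtype.val hε) i hi).symm)⟩
    · rintro ⟨γ, rfl⟩
      exact ⟨NCone.mulIncl γ.unop.1 ε.1, NCone.isIncl_mulIncl _ _⟩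

theorem op_mem_objIdeal (γ : X.connSemigroup) : op γ ∈ (objIdeal γ.1.vertex).ideal :=
  ⟨𝟙 _, NCone.isIncl_eqToHom rfl⟩

theorem op_mul_eq {ε : X.connSemigroup} (hε : IsIdempotentElem ε) (γ : X.dualConnSemigroup)
    (hγ : γ ∈ (objIdeal ε.1.vertex).ideal) : op ε * γ = γ := by
  obtain ⟨i, hi⟩ := hγ
  exact unop_injective (Subtype.ext (NCone.mul_idem_eq (congrArg Subtype.val hε) i hi))

theorem principal_op {ε : X.connSemigroup} (hε : IsIdempotentElem ε) :
    RCat.principal (op ε) = objIdeal ε.1.vertex :=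
  RCat.eq_principal (op_mem_objIdeal ε) (op_mul_eq hε)

/-- An idempotent cone with vertex $c$ belongs to the ideal of $c$, so equal ideals give inclusions
in both directions, and inclusions form a strict preorder. -/
theorem objIdeal_injective : Function.Injective (objIdeal (X := X)) := by
  have key : ∀ {c c' : X.carrier}, objIdeal c = objIdeal c' → ∃ i : c ⟶ c', IsIncl i := by
    intro c c' h
    obtain ⟨ε, hε, rfl⟩ := X.exists_idem c
    have := op_mem_objIdeal ε
    rwa [h] at this
  intro c c' h
  obtain ⟨i, hi⟩ := key h
  obtain ⟨j, hj⟩ := key h.symm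
  exact CategoryWithSubobjects.incl_antisymm i j hi hj

theorem mul_mem_objIdeal {c' : X.carrier} {ρ : X.connSemigroup} {i : ρ.1.vertex ⟶ c'}
    (hi : IsIncl i) (γ : X.dualConnSemigroup) : op ρ * γ ∈ (objIdeal c').ideal :=
  ⟨NCone.mulIncl γ.unop.1 ρ.1 ≫ i,
    CategoryWithSubobjects.incl_comp _ _ (NCone.isIncl_mulIncl _ _) hi⟩

/-- The morphism of right ideals induced by a morphism `f` of a connected category: right
multiplication by any cone of the connection semigroup whose component at the domain of `f` is `f`
up to an inclusion. -/
noncomputable def mapIdeal {c c' : X.carrier} (f : c ⟶ c') : objIdeal c ⟶ objIdeal c' :=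
  RCat.mulHom (op (X.exists_cone_app f).choose) fun γ _ =>
    mul_mem_objIdeal (X.exists_cone_app f).choose_spec.choose_spec.1 γ

/-- Frees `mapIdeal` from the chosen cone, by `mul_eq_mul`. Each later computation picks a
convenient representative: an idempotent for an inclusion, a product for a composite, an image cone
for $F(f)$. -/
theorem ap_mapIdeal {c c' : X.carrier} (f : c ⟶ c') {ρ : X.connSemigroup} {i : ρ.1.vertex ⟶ c'}
    (hi : IsIncl i) (h : ρ.1.app c ≫ i = f) (γ : (objIdeal c).ideal) :
    (RCat.ap (mapIdeal f) γ : X.dualConnSemigroup) = op ρ * γ := by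
  obtain ⟨γ, k, hk⟩ := γ
  obtain ⟨hj, h'⟩ := (X.exists_cone_app f).choose_spec.choose_spec
  exact congrArg op (mul_eq_mul hk hj hi (h'.trans h.symm))

/-- The functor from a connected category to the right category of its dual connection
semigroup. -/
noncomputable def idealFunctor (X : CC.{u}) : X.carrier ⥤ RCat X.dualConnSemigroup where
  obj := objIdeal
  map := mapIdeal
  map_id c := by
    obtain ⟨ε, hε, rfl⟩ := X.exists_idem c
    refine RCat.hom_ext fun γ => ?_
    rw [ap_mapIdeal (𝟙 _) (ρ := ε) (i := 𝟙 _) (NCone.isIncl_eqToHom rfl)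
      (by rw [NCone.app_vertex_of_idem (congrArg Subtype.val hε), Category.comp_id]),
      op_mul_eq hε _ γ.2]
    rfl
  map_comp {a b c} f g := by
    obtain ⟨ρ, i, hi, hf⟩ := X.exists_cone_app f
    obtain ⟨σ, j, hj, hg⟩ := X.exists_cone_app g
    refine RCat.hom_ext fun γ => ?_
    rw [RCat.ap_comp, ap_mapIdeal g hj hg, ap_mapIdeal f hi hf,
      -- $\rho\sigma$ represents $fg$: up to inclusions its component at `a` is
      -- $\rho(a)\sigma(z_\rho)$, and $\sigma(z_\rho)$ is the inclusion `i` followed by $\sigma(b)$.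
      ap_mapIdeal (f ≫ g) (ρ := ρ * σ) (i := NCone.mulIncl ρ.1 σ.1 ≫ j)
        (CategoryWithSubobjects.incl_comp _ _ (NCone.isIncl_mulIncl _ _) hj), op_mul, mul_assoc]
    have := NCone.mul_app ρ.1 σ.1 a
    refine (Category.assoc _ _ _).symm.trans ((congrArg (· ≫ j) this).trans ?_)
    rw [← hf, ← hg, ← σ.1.compat i hi]
    simp only [Category.assoc]

/-- A morphism `f` is determined by the value at an idempotent cone of the induced morphism of
right ideals. -/
theorem exists_eq_of_ap_mapIdeal {ε γ : X.connSemigroup} (hε : IsIdempotentElem ε)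
    {c' : X.carrier} {f : ε.1.vertex ⟶ c'}
    (h : RCat.ap (mapIdeal f) ⟨op ε, op_mem_objIdeal ε⟩ = op γ) :
    ∃ i : γ.1.vertex ⟶ c', IsIncl i ∧ γ.1.app ε.1.vertex ≫ i = f := by
  obtain ⟨ρ, i, hi, hf⟩ := X.exists_cone_app f
  rw [ap_mapIdeal f hi hf] at h
  -- The value at $\epsilon$ is $\epsilon\rho$; since $\epsilon(z_\epsilon) = 1$, this product has
  -- the same component as $\rho$ at $z_\epsilon$, up to an inclusion.
  obtain rfl : ε * ρ = γ := congrArg unop h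
  refine ⟨NCone.mulIncl ε.1 ρ.1 ≫ i,
    CategoryWithSubobjects.incl_comp _ _ (NCone.isIncl_mulIncl _ _) hi, ?_⟩
  have := NCone.mul_app ε.1 ρ.1 ε.1.vertex
  refine (Category.assoc _ _ _).symm.trans ((congrArg (· ≫ i) this).trans ?_)
  rw [NCone.app_vertex_of_idem (congrArg Subtype.val hε), Category.id_comp, hf]

/-! ### Full faithfulness and inclusions -/

instance : X.idealFunctor.Faithful where
  map_injective {c c'} f g h := by
    obtain ⟨ε, hε, rfl⟩ := X.exists_idem c
    change mapIdeal f = mapIdeal g at h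
    obtain ⟨i, hi, hf⟩ := exists_eq_of_ap_mapIdeal hε (f := f) rfl
    obtain ⟨j, hj, hg⟩ := exists_eq_of_ap_mapIdeal hε (f := g) (by rw [← h]; rfl)
    rw [← hf, ← hg, CategoryWithSubobjects.incl_unique i j hi hj]

instance : X.idealFunctor.Full where
  map_surjective {c c'} h := by
    obtain ⟨ε, hε, rfl⟩ := X.exists_idem c
    change objIdeal _ ⟶ objIdeal _ at h
    obtain ⟨⟨ρ⟩, hρ⟩ := RCat.exists_mul h
    have hk := (RCat.ap h ⟨op ε, op_mem_objIdeal ε⟩).2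
    rw [hρ] at hk
    obtain ⟨k, hk⟩ : ∃ k : (ε * ρ).1.vertex ⟶ c', IsIncl k := hk
    -- The vertex of $\rho$ need not lie below $c'$, whereas that of $\epsilon\rho$, the image of
    -- $\epsilon$, does. On the ideal of $c$ the two act alike, since $\gamma\epsilon = \gamma$
    -- there.
    refine ⟨(ε * ρ).1.app ε.1.vertex ≫ k, RCat.hom_ext fun γ => ?_⟩
    refine (ap_mapIdeal _ (ρ := ε * ρ) hk rfl γ).trans ?_
    rw [op_mul, mul_assoc, op_mul_eq hε _ γ.2]
    exact (hρ γ).symm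

/-- An inclusion of ideals sends $\epsilon$ to itself, so $f$ is the identity component
$\epsilon(z_\epsilon)$ followed by an inclusion. -/
theorem isIncl_of_mapIdeal {c c' : X.carrier} (f : c ⟶ c') (h : IsIncl (mapIdeal f)) :
    IsIncl f := by
  obtain ⟨ε, hε, rfl⟩ := X.exists_idem c
  obtain ⟨i, hi, hf⟩ := exists_eq_of_ap_mapIdeal hε (h ⟨op ε, op_mem_objIdeal ε⟩)
  rw [NCone.app_vertex_of_idem (congrArg Subtype.val hε), Category.id_comp] at hf
  rwa [← hf]

/-- An idempotent cone with vertex $c$ represents every inclusion out of $c$, and multiplying by it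
fixes the ideal of $c$. -/
theorem isIncl_mapIdeal {c c' : X.carrier} (j : c ⟶ c') (hj : IsIncl j) :
    IsIncl (mapIdeal j) := by
  obtain ⟨ε, hε, rfl⟩ := X.exists_idem c
  intro γ
  rw [ap_mapIdeal j hj (by
    rw [NCone.app_vertex_of_idem (congrArg Subtype.val hε), Category.id_comp]),
    op_mul_eq hε _ γ.2]

/-! ### Comparison of the posets of classes -/

/-- Comparing principal cones tests divisibility inside the connection semigroup, while $\mathfrak
D$ is ordered by divisibility among all cones. Regularity and the down-set condition make the two
agree. -/
theorem of_lcone_op_le {γ δ : X.connSemigroup} :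
    RClass.of (RCat.lcone (op γ)) ≤ RClass.of (RCat.lcone (op δ)) ↔
      RClass.of γ.1 ≤ RClass.of δ.1 := by
  constructor
  · intro h
    obtain ⟨u, hu⟩ := RCat.exists_of_lcone_le (RClass.of_le_of.1 h)
    exact ⟨u.unop.1, congrArg (fun a => a.unop.1) hu⟩
  · rintro ⟨x, hx⟩
    obtain ⟨y, hy, -⟩ := RegularSemigroup.exists_inverse δ
    have hy : δ.1 * y.1 * δ.1 = δ.1 := congrArg Subtype.val hy
    -- The factor $x$ may lie outside the connection semigroup. With $\delta y\delta = \delta$ it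
    -- can be replaced by $y\delta x$, which lies inside because it is $\leqslant_r$-below $y$.
    have hm : RClass.of (y.1 * (δ.1 * x)) ∈ X.D :=
      X.D.lower (RClass.of_le_of.2 ⟨_, rfl⟩) y.2
    refine RClass.of_le_of.2 (RCat.lcone_rle_of_eq (u := op ⟨_, hm⟩) ?_)
    refine unop_injective (Subtype.ext ?_)
    change γ.1 = δ.1 * (y.1 * (δ.1 * x))
    rw [← mul_assoc, ← mul_assoc, hy, hx]

/-- The order isomorphism of the down-set of a connected category with that of the right category
of its dual connection semigroup. -/
noncomputable def classMap (X : CC.{u}) : X.D →o RCat.lclasses X.dualConnSemigroup where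
  toFun d := ⟨RClass.of (RCat.lcone (op ⟨d.1.exists_of.choose, by
    change RClass.of _ ∈ X.D
    rw [d.1.exists_of.choose_spec]; exact d.2⟩)), RCat.of_lcone_mem_lclasses _⟩
  monotone' d d' h := of_lcone_op_le.2 (by
    rw [d.1.exists_of.choose_spec, d'.1.exists_of.choose_spec]; exact h)

theorem classMap_eq {d : X.D} {γ : X.connSemigroup} (h : RClass.of γ.1 = d.1) :
    (X.classMap d).1 = RClass.of (RCat.lcone (op γ)) := by
  have e := h.trans d.1.exists_of.choose_spec.symm
  exact le_antisymm (of_lcone_op_le.2 e.ge) (of_lcone_op_le.2 e.le)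

theorem exists_of_class (d : X.D) : ∃ γ : X.connSemigroup, RClass.of γ.1 = d.1 := by
  obtain ⟨γ, hγ⟩ := d.1.exists_of
  exact ⟨⟨γ, by change RClass.of γ ∈ X.D; rw [hγ]; exact d.2⟩, hγ⟩

theorem idem_lcone_op {ε : X.connSemigroup} (hε : IsIdempotentElem ε) :
    IsIdempotentElem (RCat.lcone (op ε)) :=
  RCat.lcone_idem (congrArg op hε)

/-- The CC-morphism from a connected category to the right category of its dual connection
semigroup. -/
noncomputable def toRightCategory (X : CC.{u}) : X ⟶ RCat.toCC X.dualConnSemigroup where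
  F := X.idealFunctor
  map_incl j hj := isIncl_mapIdeal j hj
  G := X.classMap
  map_connected := by
    rintro _ d ⟨ε, hε, rfl, hd⟩
    lift ε to X.connSemigroup using (by change RClass.of ε ∈ X.D; rw [hd]; exact d.2)
    replace hε : IsIdempotentElem ε := Subtype.ext hε
    exact ⟨RCat.lcone (op ε), idem_lcone_op hε, principal_op hε, (classMap_eq hd).symm⟩
  map_app d ε ε' hε hd hε' hd' hv c := by
    lift ε to X.connSemigroup using (by change RClass.of ε ∈ X.D; rw [hd]; exact d.2)
    replace hε : IsIdempotentElem ε := Subtype.ext hε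
    -- An idempotent cone is determined by its class and vertex. Once identified, both sides of the
    -- condition are right multiplication by $\epsilon$, which represents its own component at `c`.
    obtain rfl : ε' = RCat.lcone (op ε) := NCone.idem_unique hε' (idem_lcone_op hε)
      (RClass.of_le_of.1 (hd'.trans (classMap_eq hd)).le) (hv.trans (principal_op hε).symm)
    refine RCat.hom_ext fun y => (RCat.ap_eqToHom _ _).trans ?_
    exact ap_mapIdeal _ (NCone.isIncl_eqToHom rfl) (Category.comp_id _) y

instance isIso_toRightCategory (X : CC.{u}) : IsIso X.toRightCategory := by
  have : (Hom.F X.toRightCategory).Full := inferInstanceAs X.idealFunctor.Full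
  have : (Hom.F X.toRightCategory).Faithful := inferInstanceAs X.idealFunctor.Faithful
  refine isIso_of _ ⟨objIdeal_injective, fun Z => ?_⟩ (fun j hj => isIncl_of_mapIdeal j hj)
    (fun d => ?_) (fun d d' h => ?_) fun c d h => ?_
  · obtain ⟨⟨ε⟩, hε, heZ, h⟩ := Z.exists_idem
    have hε : IsIdempotentElem ε := congrArg unop hε
    -- The preimage of a right ideal is the vertex of any idempotent that generates it.
    exact ⟨ε.1.vertex, (principal_op hε).symm.trans (RCat.eq_principal heZ h)⟩
  · obtain ⟨⟨ε⟩, hε, hd⟩ := d.2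
    exact ⟨⟨_, ε.2⟩, Subtype.ext ((classMap_eq rfl).trans hd.symm)⟩
  · obtain ⟨γ, hγ⟩ := exists_of_class d
    obtain ⟨δ, hδ⟩ := exists_of_class d'
    change (X.classMap d).1 ≤ (X.classMap d').1 at h
    change d.1 ≤ d'.1
    rw [classMap_eq hγ, classMap_eq hδ, of_lcone_op_le] at h
    rwa [← hγ, ← hδ]
  · obtain ⟨γ, hγ⟩ := exists_of_class d
    obtain ⟨ε', hε', hv, hd⟩ := h
    have hd := hd.trans (classMap_eq hγ)
    -- A connecting idempotent cone in the class of a principal cone is itself principal;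
    -- injectivity of $a \mapsto l^a$ makes its parameter an idempotent cone of $X$, with the
    -- required vertex and class.
    obtain ⟨u, rfl⟩ := RCat.eq_lcone_of_rle (RClass.of_le_of.1 hd.le)
    obtain ⟨ε, hε₁⟩ := op_surjective (u * op γ)
    rw [← hε₁] at hε' hv hd
    have hε : IsIdempotentElem ε :=
      congrArg unop (RCat.lcone_injective ((RCat.lcone_mul _ _).symm.trans hε'))
    refine ⟨ε.1, congrArg Subtype.val hε,
      objIdeal_injective ((principal_op hε).symm.trans hv), ?_⟩
    exact (le_antisymm (of_lcone_op_le.1 hd.le) (of_lcone_op_le.1 hd.ge)).trans hγ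

/-! ### Naturality of the comparison -/

theorem mapCone_idem {Y : CC.{u}} (m : X ⟶ Y) {ε : X.connSemigroup} (hε : IsIdempotentElem ε) :
    IsIdempotentElem (Hom.mapCone m ε) :=
  (Hom.mapCone_mul m ε ε).symm.trans (congrArg _ hε)

/-- `mapCone_spec` supplies only an inclusion of vertices. For an idempotent, the component at
$F(z_\epsilon)$ followed by this inclusion is $F(1) = 1$, so that component is an inclusion back. -/
theorem mapCone_vertex {Y : CC.{u}} (m : X ⟶ Y) {ε : X.connSemigroup}
    (hε : IsIdempotentElem ε) : (Hom.mapCone m ε).1.vertex = m.F.obj ε.1.vertex := by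
  obtain ⟨-, i, hi, h⟩ := Hom.mapCone_spec m ε
  refine CategoryWithSubobjects.incl_antisymm i ((Hom.mapCone m ε).1.app _) hi
    (CategoryWithSubobjects.incl_of_comp _ i ?_ hi)
  rw [h, NCone.app_vertex_of_idem (congrArg Subtype.val hε), CategoryTheory.Functor.map_id]
  exact NCone.isIncl_eqToHom rfl

/-- The homomorphism of dual connection semigroups induced by a CC-morphism. -/
noncomputable def dualMap {Y : CC.{u}} (m : X ⟶ Y) :
    X.dualConnSemigroup →ₙ* Y.dualConnSemigroup :=
  (toRRS.map m).hom.hom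

theorem mapObj_objIdeal {Y : CC.{u}} (m : X ⟶ Y) (c : X.carrier) :
    RCat.mapObj (dualMap m) (objIdeal c) = objIdeal (m.F.obj c) := by
  obtain ⟨ε, hε, rfl⟩ := X.exists_idem c
  rw [← principal_op hε, ← mapCone_vertex m hε, ← principal_op (mapCone_idem m hε)]
  exact RCat.mapObj_principal _ _

/-- If $\rho$ represents $f$, its image under `mapCone` represents $F(f)$, so both sides are right
multiplication by that image. -/
theorem mapIdeal_map {Y : CC.{u}} (m : X ⟶ Y) {c c' : X.carrier} (f : c ⟶ c') :
    mapIdeal (m.F.map f) = eqToHom (mapObj_objIdeal m c).symm ≫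
      RCat.mapHom (dualMap m) (mapIdeal f) ≫ eqToHom (mapObj_objIdeal m c') := by
  obtain ⟨ρ, i, hi, hf⟩ := X.exists_cone_app f
  obtain ⟨-, j, hj, h⟩ := Hom.mapCone_spec m ρ
  refine RCat.hom_ext fun y => ?_
  rw [ap_mapIdeal (m.F.map f) (ρ := Hom.mapCone m ρ) (i := j ≫ m.F.map i)
    (CategoryWithSubobjects.incl_comp _ _ hj (m.map_incl _ hi))
    (by rw [← Category.assoc, h, ← Functor.map_comp, hf])]
  rw [RCat.ap_comp, RCat.ap_comp, RCat.ap_eqToHom]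
  refine Eq.trans ?_ (RCat.ap_mapHom (dualMap m) (mapIdeal f)
    (ap_mapIdeal f hi hf) _).symm
  exact congrArg (op (Hom.mapCone m ρ) * ·) (RCat.ap_eqToHom _ y).symm

theorem toRightCategory_naturality {Y : CC.{u}} (m : X ⟶ Y) :
    m ≫ Y.toRightCategory = X.toRightCategory ≫ RCat.mapCC (dualMap m) := by
  refine CC.hom_ext (CategoryTheory.Functor.ext (fun c => (mapObj_objIdeal m c).symm)
    fun c c' f => mapIdeal_map m f) fun d => Subtype.ext ?_
  · obtain ⟨γ, hγ⟩ := exists_of_class d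
    -- For $\gamma$ in the class `d`, both composites give the class of the principal cone of the
    -- image of $\gamma$.
    refine (classMap_eq (γ := Hom.mapCone m γ) ?_).trans
      (RCat.mapClass_eq (dualMap m) (X.classMap d) (classMap_eq hγ).symm).symm
    rw [(Hom.mapCone_spec m γ).1]
    exact congrArg (fun d => (m.G d).1) (Subtype.ext hγ)

end CC

/-- The isomorphisms `X ≅ C(S(X))` are natural. -/
noncomputable def counitNatIso : 𝟭 CC.{u} ≅ CC.toRRS ⋙ RRS.toCC :=
  NatIso.ofComponents (fun X => @asIso _ _ _ _ X.toRightCategory X.isIso_toRightCategory)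
    fun m => CC.toRightCategory_naturality m

end ConnCat

theorem mainTheorem6 :
    ∃ e : ConnCat.RRS.{u} ≌ ConnCat.CC.{u},
      e.functor = ConnCat.RRS.toCC ∧ e.inverse = ConnCat.CC.toRRS :=
  -- The two natural isomorphisms need not satisfy the triangle identity: `Equivalence.mk` corrects
  -- the unit and leaves both functors untouched, so the equalities are definitional.
  ⟨CategoryTheory.Equivalence.mk _ _ ConnCat.unitNatIso ConnCat.counitNatIso.symm, rfl, rfl⟩
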